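/- Let $G$ be a finite simple graph. A biclique of $G$ is a complete bipartite subgraph of $G$ (not necessarily induced), and the biclique covering number $\mathsf{bc}(G)$ is the minimum number of bicliques of $G$ required to cover all edges of $G$. For positive integers $p,q$, let $G_{p,q}$ be the $p\times q$ grid graph: its vertex set is $\{1,\dots,q\}\times\{1,\dots,p\}$, and $(a,b)$ is adjacent to $(a',b')$ if and only if $|a-a'|+|b-b'|=1$. **Theorem.** For all integers $1\le p\le q$, \[ \mathsf{bc}(G_{p,q})= \begin{cases} \frac{pq}{2}-1, & \text{if } p \text{ is even and } q-1=k(p-1)+2\ell \text{ for some integers } 0\le \ell<k,\\[4pt] \left\lfloor \frac{pq}{2}\right\rfloor, & \text{otherwise.} \end{cases} \] -/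

import Mathlib

/-- The `p × q` grid graph: its vertex set is `[q] × [p]` (indexed from `0`), and `(a, b)` is
adjacent to `(a', b')` if and only if `|a - a'| + |b - b'| = 1`. -/
def gridGraph (p q : ℕ) : SimpleGraph (Fin q × Fin p) where
  Adj u v := |((u.1 : ℕ) : ℤ) - ((v.1 : ℕ) : ℤ)| + |((u.2 : ℕ) : ℤ) - ((v.2 : ℕ) : ℤ)| = 1
  symm := ⟨fun u v h => by
    rw [abs_sub_comm ((v.1 : ℕ) : ℤ), abs_sub_comm ((v.2 : ℕ) : ℤ)]
    exact h⟩
  loopless := ⟨fun u h => by simp at h⟩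

/-- A biclique of `G`: a subgraph of `G` (not necessarily induced) that is a complete bipartite
graph with nonempty sides `A` and `B`. -/
def IsBiclique {V : Type*} {G : SimpleGraph V} (H : G.Subgraph) : Prop :=
  ∃ A B : Set V, A.Nonempty ∧ B.Nonempty ∧ Disjoint A B ∧ H.verts = A ∪ B ∧
    ∀ u v : V, H.Adj u v ↔ (u ∈ A ∧ v ∈ B) ∨ (u ∈ B ∧ v ∈ A)

/-- A biclique cover of `G`: a set of bicliques of `G` that together contain every edge of `G`. -/
def IsBicliqueCover {V : Type*} (G : SimpleGraph V) (C : Set G.Subgraph) : Prop :=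
  (∀ H ∈ C, IsBiclique H) ∧ ∀ e ∈ G.edgeSet, ∃ H ∈ C, e ∈ H.edgeSet

/-- The biclique covering number of `G`: the minimum number of bicliques of `G` required to cover
the edges of `G`, as an element of `ℕ ∪ {∞}`. -/
noncomputable def bicliqueCoveringNumber {V : Type*} (G : SimpleGraph V) : ℕ∞ :=
  ⨅ (C : Set G.Subgraph) (_ : IsBicliqueCover G C), C.encard

/-!
A biclique of the grid lies in a star or in a unit square (a `4`-cycle), so the biclique covering
number is the least `|X| + |S|` over all sets `X` of star centres and `S` of unit squares that
together cover the edges (`bicliqueCoveringNumber_gridGraph_eq`). One colour class of the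
checkerboard gives the upper bound `⌊pq/2⌋`.

*Lower bound.* Call an edge a ring edge if it lies on one of the concentric rectangles around the
grid. Every star contains at most two ring edges, and so does every square, except that for even `p`
each of the two squares at the ends of the innermost ring has one more. There are `pq` ring edges
for even `p` and at least `pq - 1` for odd `p`. Counting gives `|X| + |S| ≥ pq/2 - 1` for even `p`
and `|X| + |S| ≥ (pq - 1)/2` for odd `p`, which settles odd `p`.

*Upper bound in the exceptional case.* For even `p`, a diagonal of `p - 1` squares running from the
top row to the bottom row, with stars on alternate points off the diagonal, saves one star. The
diagonal can be reflected at the bottom and at the top and run through the grid several times;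
before each reflected diagonal two columns without squares may be inserted. This reaches exactly the
values `q = 1 + k(p - 1) + 2l` with `0 ≤ l < k` (`GridCover.exists_card_le_of_eq`).

*Necessity of the condition.* Let `p = 2m + 2 < q` and suppose that the lower bound is attained.
Then every ring edge is covered exactly once, both end squares of the innermost ring are used, and
after trading squares for stars no square contains a star centre (`GridCover.rigidCover`). In this
situation the cover is determined by few parameters. In the left part it is forced by the left end
square: the squares fill a diagonal band of some half-width `2i`, with checkerboards on both sides
(`CornerRigid.shape`). In the central columns all horizontal edges are ring edges, and this forces
the band to continue to the bottom row and be reflected, possibly after two columns without squares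
(`StripRigid.blockShape`, `StripRigid.blockShape_of_startColumn`, `StripRigid.flat`). The cover is
therefore a sequence of blocks. Reading the grid from the right gives a block of `p` columns at the
right end, and comparing the two descriptions of one column (`aligned_match`) shows that it is the
last block of the sequence. Adding up the widths yields the arithmetic condition
(`RigidCover.exists_eq`).
-/

/-! ### Tight covers near a corner -/

/-- The conditions that a tight cover satisfies near the corner `(0, 0)` of the grid. A point
`(c, r)` lies in column `c` and row `r`. `Y c r` says that `(c, r)` is a vertex that is not the
centre of a star, and `S c r` that the unit square with corners `(c, r)` and `(c + 1, r + 1)` is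
used. A horizontal edge is named by its left end and a vertical edge by its smaller row. The
fields `covH`, `covV` say that every edge is covered; `exH`, `altH`, `exV`, `altV` that the ring
edges within distance `2 * m` of the corner are not covered twice by squares or by stars. -/
structure CornerRigid (m : ℤ) (Y S : ℤ → ℤ → Prop) : Prop where
  dom : ∀ c r, Y c r → 0 ≤ c ∧ 0 ≤ r
  full : ∀ c r, S c r → Y c r ∧ Y (c + 1) r ∧ Y c (r + 1) ∧ Y (c + 1) (r + 1)
  covH : ∀ c r, Y c r → Y (c + 1) r → S c r ∨ S c (r - 1)
  covV : ∀ c r, Y c r → Y c (r + 1) → S c r ∨ S (c - 1) r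
  exH : ∀ c r, 0 ≤ r → r ≤ c → c + r ≤ 2 * m → S c r → ¬ S c (r - 1)
  altH : ∀ c r, 0 ≤ r → r ≤ c → c + r ≤ 2 * m → Y c r ∨ Y (c + 1) r
  exV : ∀ c r, 0 ≤ c → c ≤ r → c + r ≤ 2 * m → S c r → ¬ S (c - 1) r
  altV : ∀ c r, 0 ≤ c → c ≤ r → c + r ≤ 2 * m → Y c r ∨ Y c (r + 1)
  mid : S m m

namespace CornerRigid

variable {m : ℤ} {Y S : ℤ → ℤ → Prop}

theorem transpose (h : CornerRigid m Y S) :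
    CornerRigid m (fun c r => Y r c) (fun c r => S r c) where
  dom c r hy := (h.dom r c hy).symm
  full c r hs := by
    have := h.full r c hs
    tauto
  covH c r := h.covV r c
  covV c r := h.covH r c
  exH c r h0 h1 h2 := h.exV r c h0 h1 (by omega)
  altH c r h0 h1 h2 := h.altV r c h0 h1 (by omega)
  exV c r h0 h1 h2 := h.exH r c h0 h1 (by omega)
  altV c r h0 h1 h2 := h.altH r c h0 h1 (by omega)
  mid := h.mid

/-- The start `i` of the maximal run of diagonal squares `(i, i), …, (m, m)`. -/
theorem exists_diagonal_start (h : CornerRigid m Y S) :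
    ∃ i, 0 ≤ i ∧ i ≤ m ∧ (∀ k, i ≤ k → k ≤ m → S k k) ∧ (0 < i → ¬ S (i - 1) (i - 1)) := by
  have hm : 0 ≤ m := (h.dom _ _ (h.full _ _ h.mid).1).1
  have key : ∀ n : ℕ, ∀ j : ℤ, j = n → j ≤ m → (∀ k, j ≤ k → k ≤ m → S k k) →
      ∃ i, 0 ≤ i ∧ i ≤ m ∧ (∀ k, i ≤ k → k ≤ m → S k k) ∧ (0 < i → ¬ S (i - 1) (i - 1)) := by
    intro n
    induction n with
    | zero => exact fun j hj hjm H => ⟨j, by omega, hjm, H, by omega⟩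
    | succ n ih =>
      intro j hj hjm H
      by_cases hS : S (j - 1) (j - 1)
      · refine ih (j - 1) (by push_cast at hj; omega) (by omega) fun k hk hkm => ?_
        rcases eq_or_lt_of_le hk with rfl | hlt
        · exact hS
        · exact H k (by omega) hkm
      · exact ⟨j, by omega, hjm, H, fun _ => hS⟩
  refine key m.toNat m (by omega) le_rfl fun k h1 h2 => ?_
  obtain rfl : k = m := by omega
  exact h.mid

variable {i : ℤ}

/-- From the first diagonal square `(i, i)`, squares follow along the antidiagonal `c + r = 2 * i`
up to the boundary. -/
theorem leaf (h : CornerRigid m Y S) (hi : 0 ≤ i) (him : i ≤ m) (hS : S i i)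
    (hi' : 0 < i → ¬ S (i - 1) (i - 1)) (j : ℕ) (hj : (j : ℤ) ≤ i) :
    S (i + j) (i - j) ∧ ¬ Y (i + j) (i - j - 1) := by
  induction j with
  | zero =>
    simp only [Nat.cast_zero, add_zero, sub_zero]
    refine ⟨hS, fun hY => ?_⟩
    -- For `i = 0` the vertex `(0, -1)` lies outside the grid.
    have hpos : 0 < i := by have := (h.dom _ _ hY).2; omega
    have := h.covV i (i - 1) hY (by simpa using (h.full _ _ hS).1)
    rcases this with h1 | h1
    · exact h.exH i i hi le_rfl (by omega) hS h1
    · exact hi' hpos h1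
  | succ j ih =>
    push_cast at hj ⊢
    obtain ⟨hs, hn⟩ := ih (by omega)
    have hY : Y (i + (j + 1)) (i - (j + 1)) := by
      have := h.altH (i + j) (i - j - 1) (by omega) (by omega) (by omega)
      rw [show i + ((j : ℤ) + 1) = i + j + 1 by ring, show i - ((j : ℤ) + 1) = i - j - 1 by ring]
      tauto
    have hE := (h.full _ _ hs).2.1
    have hs' : S (i + (j + 1)) (i - (j + 1)) := by
      have h1 := h.covV _ _ hY (by convert hE using 1 <;> ring)
      rcases h1 with h1 | h1
      · exact h1
      · refine absurd ?_ (h.exH _ _ (by omega) (by omega) (by omega) hs)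
        convert h1 using 1 <;> ring
    refine ⟨hs', fun hN => ?_⟩
    have h1 := h.covV _ _ hN (by convert hY using 1; ring)
    rcases h1 with h1 | h1
    · exact h.exH _ _ (by omega) (by omega) (by omega) hs' h1
    · apply hn
      convert (h.full _ _ h1).2.2.1 using 1 <;> ring

/-- In the triangle cut off by the antidiagonal `c + r = 2 * i`, the set `Y` is one colour class of
the checkerboard. The induction moves from that antidiagonal towards the corner. -/
theorem triangle (h : CornerRigid m Y S) (hi : 0 ≤ i) (him : i ≤ m) (hS : S i i)
    (hi' : 0 < i → ¬ S (i - 1) (i - 1)) (n : ℕ) (s : ℤ) (hn : s = i - n) :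
    (∀ c r, 0 ≤ r → r ≤ c → c + r = 2 * s → Y c r) ∧
    (∀ c r, 0 ≤ r → r ≤ c → c + r = 2 * s - 1 → ¬ Y c r) := by
  induction n generalizing s with
  | zero =>
    have hs : s = i := by simpa using hn
    subst hs
    constructor
    · intro c r h0 h1 h2
      have := (h.full _ _ (h.leaf hi him hS hi' (c - s).toNat (by omega)).1).1
      convert this using 1 <;> omega
    · intro c r h0 h1 h2
      have := (h.leaf hi him hS hi' (c - s).toNat (by omega)).2
      convert this using 2 <;> omega
  | succ n ih =>
    obtain ⟨ih1, ih2⟩ := ih (s + 1) (by push_cast at hn; omega)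
    have hE : ∀ c r, 0 ≤ r → r ≤ c → c + r = 2 * s → Y c r := by
      intro c r h0 h1 h2
      have := h.altH c r h0 h1 (by push_cast at hn; omega)
      have := ih2 (c + 1) r h0 (by omega) (by omega)
      tauto
    refine ⟨hE, ?_⟩
    have key : ∀ k : ℕ, ∀ c r : ℤ, r = k → r ≤ c → c + r = 2 * s - 1 → ¬ Y c r := by
      intro k
      induction k with
      | zero =>
        intro c r hr h1 h2 hY
        have hR := hE (c + 1) r (by omega) (by omega) (by omega)
        rcases h.covH c r hY hR with h3 | h3
        · exact ih2 (c + 1) (r + 1) (by omega) (by omega) (by omega) (h.full _ _ h3).2.2.2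
        · have := (h.dom _ _ (h.full _ _ h3).1).2
          omega
      | succ k ihk =>
        intro c r hr h1 h2 hY
        have hR := hE (c + 1) r (by omega) (by omega) (by omega)
        rcases h.covH c r hY hR with h3 | h3
        · exact ih2 (c + 1) (r + 1) (by omega) (by omega) (by omega) (h.full _ _ h3).2.2.2
        · exact ihk (c + 1) (r - 1) (by push_cast at hr; omega) (by omega) (by omega)
            (h.full _ _ h3).2.1
    exact fun c r h0 => key r.toNat c r (by omega)

/-- Beyond the antidiagonal `c + r = 2 * i`, the squares fill the diagonal band `|c - r| ≤ 2 * i`,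
one antidiagonal after the other, and the vertices of even coordinate sum outside the band are
star centres. -/
theorem band_upper (h : CornerRigid m Y S) (hi : 0 ≤ i)
    (hd : ∀ k, i ≤ k → k ≤ m → S k k)
    (hi' : 0 < i → ¬ S (i - 1) (i - 1)) (n : ℕ) (s : ℤ) (hn : s = i + n) (hsm : s ≤ m) :
    (∀ c r, 0 ≤ r → r ≤ c → c + r = 2 * s → (Y c r ↔ c - r ≤ 2 * i)) ∧
    (∀ c r, 0 ≤ r → r ≤ c → c + r = 2 * s → c - r ≤ 2 * i → S c r) ∧
    (∀ c r, 0 ≤ r → r ≤ c → c + r = 2 * s + 1 → Y c r) := by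
  induction n generalizing s with
  | zero =>
    have hs : s = i := by simpa using hn
    subst hs
    have hS : S s s := hd s le_rfl hsm
    have h2 : ∀ c r, 0 ≤ r → r ≤ c → c + r = 2 * s → S c r := by
      intro c r h0 h1 h2
      have := (h.leaf hi hsm hS hi' (c - s).toNat (by omega)).1
      convert this using 1 <;> omega
    refine ⟨fun c r h0 h1 h3 => ⟨fun _ => by omega, fun _ => (h.full _ _ (h2 c r h0 h1 h3)).1⟩,
      fun c r h0 h1 h3 _ => h2 c r h0 h1 h3, fun c r h0 h1 h3 => ?_⟩
    have := (h.full _ _ (h2 (c - 1) r h0 (by omega) (by omega))).2.1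
    simpa using this
  | succ n ih =>
    push_cast at hn
    obtain ⟨ihF, ihS, ihG⟩ := ih (s - 1) (by omega) (by omega)
    have hSq : ∀ j : ℕ, (j : ℤ) ≤ i → S (s + j) (s - j) := by
      intro j
      induction j with
      | zero => exact fun _ => by simpa using hd s (by omega) hsm
      | succ j ihj =>
        intro hj
        push_cast at hj ⊢
        have hu := ihj (by omega)
        have hNW := ihS (s + j) (s - j - 2) (by omega) (by omega) (by omega) (by omega)
        have hY : Y (s + (j + 1)) (s - (j + 1)) := by
          convert (h.full _ _ hNW).2.2.2 using 1 <;> ring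
        have hE : Y (s + (j + 1)) (s - (j + 1) + 1) := by
          convert (h.full _ _ hu).2.1 using 1 <;> ring
        rcases h.covV _ _ hY hE with h1 | h1
        · exact h1
        · refine absurd ?_ (h.exH _ _ (by omega) (by omega) (by omega) hu)
          convert h1 using 1 <;> ring
    have hSq' : ∀ c r, 0 ≤ r → r ≤ c → c + r = 2 * s → c - r ≤ 2 * i → S c r := by
      intro c r h0 h1 h2 h3
      have := hSq (c - s).toNat (by omega)
      convert this using 1 <;> omega
    -- Outside the band, the left neighbour is in `Y`, so a point of `Y` there would need a square
    -- that meets the band from the side or the previous antidiagonal.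
    have hout : ∀ k : ℕ, ∀ c r, 0 ≤ r → r ≤ c → c + r = 2 * s → c - r = 2 * i + 2 + 2 * k →
        ¬ Y c r := by
      intro k
      induction k with
      | zero =>
        intro c r h0 h1 h2 h3 hY
        have hW := ihG (c - 1) r h0 (by omega) (by omega)
        rcases h.covH (c - 1) r hW (by simpa using hY) with h4 | h4
        · have h5 := hSq' (c - 1) (r + 1) (by omega) (by omega) (by omega) (by omega)
          exact h.exH (c - 1) (r + 1) (by omega) (by omega) (by omega) h5 (by simpa using h4)
        · have h5 := (h.full _ _ h4).1
          have h6 := (h.dom _ _ h5).2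
          have := (ihF (c - 1) (r - 1) h6 (by omega) (by omega)).1 h5
          omega
      | succ k ihk =>
        intro c r h0 h1 h2 h3 hY
        push_cast at h3
        have hW := ihG (c - 1) r h0 (by omega) (by omega)
        rcases h.covH (c - 1) r hW (by simpa using hY) with h4 | h4
        · exact ihk (c - 1) (r + 1) (by omega) (by omega) (by omega) (by omega)
            (h.full _ _ h4).2.2.1
        · have h5 := (h.full _ _ h4).1
          have h6 := (h.dom _ _ h5).2
          have := (ihF (c - 1) (r - 1) h6 (by omega) (by omega)).1 h5
          omega
    have hF : ∀ c r, 0 ≤ r → r ≤ c → c + r = 2 * s → (Y c r ↔ c - r ≤ 2 * i) := by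
      intro c r h0 h1 h2
      refine ⟨fun hY => ?_, fun h3 => (h.full _ _ (hSq' c r h0 h1 h2 h3)).1⟩
      by_contra hcon
      exact hout ((c - r - 2 * i - 2) / 2).toNat c r h0 h1 h2 (by omega) hY
    refine ⟨hF, hSq', fun c r h0 h1 h2 => ?_⟩
    rcases h.altH (c - 1) r h0 (by omega) (by omega) with h3 | h3
    · have h4 := (hF (c - 1) r h0 (by omega) (by omega)).1 h3
      simpa using (h.full _ _ (hSq' (c - 1) r h0 (by omega) (by omega) h4)).2.1
    · simpa using h3

/-- The complete shape of a tight cover in the triangle `c + r ≤ 2 * m + 1`: it depends on a single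
parameter `i`. -/
theorem shape (h : CornerRigid m Y S) : ∃ i, 0 ≤ i ∧ i ≤ m ∧
    (∀ c r, 0 ≤ c → 0 ≤ r → c + r ≤ 2 * i → (Y c r ↔ (c + r) % 2 = 0)) ∧
    (∀ c r, 0 ≤ c → 0 ≤ r → 2 * i ≤ c + r → c + r ≤ 2 * m → (c + r) % 2 = 0 →
      (Y c r ↔ c - r ≤ 2 * i ∧ r - c ≤ 2 * i)) ∧
    (∀ c r, 0 ≤ c → 0 ≤ r → 2 * i ≤ c + r → c + r ≤ 2 * m → (c + r) % 2 = 0 →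
      c - r ≤ 2 * i → r - c ≤ 2 * i → S c r) ∧
    (∀ c r, 0 ≤ c → 0 ≤ r → 2 * i < c + r → c + r ≤ 2 * m + 1 → (c + r) % 2 = 1 → Y c r) := by
  obtain ⟨i, hi, him, hd, hi'⟩ := h.exists_diagonal_start
  have h' := h.transpose
  have tri : ∀ {Y S : ℤ → ℤ → Prop}, CornerRigid m Y S → (∀ k, i ≤ k → k ≤ m → S k k) →
      (0 < i → ¬ S (i - 1) (i - 1)) →
      ∀ c r, 0 ≤ r → r ≤ c → c + r ≤ 2 * i → (Y c r ↔ (c + r) % 2 = 0) := by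
    intro Y S h hd hi' c r h0 h1 h2
    constructor
    · intro hY
      by_contra hc
      exact (h.triangle hi him (hd i le_rfl him) hi' (i - (c + r + 1) / 2).toNat
        ((c + r + 1) / 2) (by omega)).2 c r h0 h1 (by omega) hY
    · intro he
      exact (h.triangle hi him (hd i le_rfl him) hi' (i - (c + r) / 2).toNat
        ((c + r) / 2) (by omega)).1 c r h0 h1 (by omega)
  refine ⟨i, hi, him, fun c r hc hr h2 => ?_, fun c r hc hr h2 h3 h4 => ?_,
    fun c r hc hr h2 h3 h4 h5 h6 => ?_, fun c r hc hr h2 h3 h4 => ?_⟩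
  · rcases le_total r c with h1 | h1
    · exact tri h hd hi' c r hr h1 h2
    · rw [add_comm] at h2 ⊢
      exact tri h' hd hi' r c hc h1 h2
  · rcases le_total r c with h1 | h1
    · rw [(h.band_upper hi hd hi' ((c + r) / 2 - i).toNat ((c + r) / 2) (by omega)
        (by omega)).1 c r hr h1 (by omega)]
      omega
    · rw [(h'.band_upper hi hd hi' ((c + r) / 2 - i).toNat ((c + r) / 2) (by omega)
        (by omega)).1 r c hc h1 (by omega)]
      omega
  · rcases le_total r c with h1 | h1
    · exact (h.band_upper hi hd hi' ((c + r) / 2 - i).toNat ((c + r) / 2) (by omega)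
        (by omega)).2.1 c r hr h1 (by omega) h5
    · exact (h'.band_upper hi hd hi' ((c + r) / 2 - i).toNat ((c + r) / 2) (by omega)
        (by omega)).2.1 r c hc h1 (by omega) h6
  · rcases le_total r c with h1 | h1
    · exact (h.band_upper hi hd hi' ((c + r) / 2 - i).toNat ((c + r) / 2) (by omega)
        (by omega)).2.2 c r hr h1 (by omega)
    · exact (h'.band_upper hi hd hi' ((c + r) / 2 - i).toNat ((c + r) / 2) (by omega)
        (by omega)).2.2 r c hc h1 (by omega)

end CornerRigid

/-! ### Tight covers in a central strip -/

/-- The conditions that a tight cover of a grid with `2 * m + 2` rows satisfies in the columns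
`0, …, C` of a central strip, in which all horizontal edges with `t ≤ c + r` are ring edges. The
notation is that of `CornerRigid`; only horizontal ring edges are used. Columns outside the strip
may exist. -/
structure StripRigid (m C t : ℤ) (Y S : ℤ → ℤ → Prop) : Prop where
  rows : ∀ c r, Y c r → 0 ≤ r ∧ r ≤ 2 * m + 1
  full : ∀ c r, S c r → Y c r ∧ Y (c + 1) r ∧ Y c (r + 1) ∧ Y (c + 1) (r + 1)
  covH : ∀ c r, Y c r → Y (c + 1) r → S c r ∨ S c (r - 1)
  covV : ∀ c r, Y c r → Y c (r + 1) → S c r ∨ S (c - 1) r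
  exH : ∀ c r, 0 ≤ c → c < C → 0 ≤ r → r ≤ 2 * m + 1 → t ≤ c + r → S c r → ¬ S c (r - 1)
  altH : ∀ c r, 0 ≤ c → c < C → 0 ≤ r → r ≤ 2 * m + 1 → t ≤ c + r → Y c r ∨ Y (c + 1) r

/-- On the antidiagonals `c + r = 2 * s` and `c + r = 2 * s + 1` the cover looks like a band of
squares `|c - r| ≤ 2 * i`. -/
structure BandAt (m i C : ℤ) (Y S : ℤ → ℤ → Prop) (s : ℤ) : Prop where
  even : ∀ c r, 0 ≤ c → c ≤ C → 0 ≤ r → r ≤ 2 * m + 1 → c + r = 2 * s →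
    (Y c r ↔ c - r ≤ 2 * i ∧ r - c ≤ 2 * i)
  square : ∀ c r, 0 ≤ c → c ≤ C → 0 ≤ r → c + r = 2 * s → c - r ≤ 2 * i → r - c ≤ 2 * i → S c r
  odd : ∀ c r, 0 ≤ c → c ≤ C → 0 ≤ r → r ≤ 2 * m + 1 → c + r = 2 * s + 1 → Y c r

/-- In a block with parameter `i` (a `(2 * m + 2) × (2 * m + 2)` piece of the grid crossed by a
diagonal band of squares), the point `(c, r)` lies in one of the two triangles where `Y` consists
of the points of even coordinate sum, or is an even point of the band. Then `Y` holds at `(c, r)`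
exactly if evenness of `c + r` agrees with `Aligned`. -/
def Aligned (m i c r : ℤ) : Prop :=
  c + r ≤ 2 * i ∨ 4 * m + 2 - 2 * i ≤ c + r ∨
    ((c + r) % 2 = 0 ∧ c - r ≤ 2 * i ∧ r - c ≤ 2 * i)

/-- The part of the strip in columns `0, …, min C (2 * m + 1)` is a block with parameter `i`. -/
structure BlockShape (m i C : ℤ) (Y S : ℤ → ℤ → Prop) : Prop where
  vertex : ∀ c r, 0 ≤ c → c ≤ C → c ≤ 2 * m + 1 → 0 ≤ r → r ≤ 2 * m + 1 →
    (Y c r ↔ ((c + r) % 2 = 0 ↔ Aligned m i c r))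
  square : ∀ c r, 0 ≤ c → c ≤ C → 0 ≤ r → (c + r) % 2 = 0 → 2 * i ≤ c + r →
    c + r ≤ 4 * m - 2 * i → c - r ≤ 2 * i → r - c ≤ 2 * i → S c r

namespace StripRigid

variable {m i C t s : ℤ} {Y S : ℤ → ℤ → Prop}

/-- The squares of one antidiagonal put the band points of the next one into `Y`. -/
theorem even_mem (h : StripRigid m C t Y S) (his : i ≤ s) (hb : BandAt m i C Y S s)
    (c r : ℤ) (hc : 0 ≤ c) (hcC : c ≤ C) (hr : 0 ≤ r) (hs : c + r = 2 * s + 2)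
    (h1 : c - r ≤ 2 * i) (h2 : r - c ≤ 2 * i) : S (c - 1) (r - 1) ∧ Y c r := by
  have h3 := hb.square (c - 1) (r - 1) (by omega) (by omega) (by omega) (by omega) (by omega)
    (by omega)
  exact ⟨h3, by simpa using (h.full _ _ h3).2.2.2⟩

/-- Even points below the band are star centres; the column `0` starts the induction. -/
theorem lower_not_mem (h : StripRigid m C t Y S) (hi : 0 ≤ i)
    (hcol : ∀ r, 2 * i < r → r ≤ 2 * m + 1 → (Y 0 r ↔ r % 2 = 1))
    (hb : BandAt m i C Y S s) (n : ℕ) :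
    ∀ c r : ℤ, c = n → c ≤ C → 0 ≤ r → c + r = 2 * s + 2 → 2 * i < r - c → ¬ Y c r := by
  induction n with
  | zero =>
    intro c r hc hcC hr hs hd hY
    have hc' : c = 0 := by simpa using hc
    subst hc'
    have := (hcol r (by omega) (h.rows _ _ hY).2).1 hY
    omega
  | succ n ih =>
    intro c r hc hcC hr hs hd hY
    push_cast at hc
    have hrP := (h.rows _ _ hY).2
    have hW := hb.odd (c - 1) r (by omega) (by omega) hr hrP (by omega)
    rcases h.covH (c - 1) r hW (by simpa using hY) with h1 | h1
    · exact ih (c - 1) (r + 1) (by omega) (by omega) (by omega) (by omega) (by omega)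
        (h.full _ _ h1).2.2.1
    · have := (hb.even (c - 1) (r - 1) (by omega) (by omega) (by omega) (by omega)
        (by omega)).1 (h.full _ _ h1).1
      omega

theorem band_succ (h : StripRigid m C t Y S) (hi : 0 ≤ i) (his : i ≤ s)
    (hcol : ∀ r, 2 * i < r → r ≤ 2 * m + 1 → (Y 0 r ↔ r % 2 = 1))
    (hts : t ≤ 2 * s + 1) (hsm : s + 1 ≤ 2 * m - i)
    (hb : BandAt m i C Y S s) : BandAt m i C Y S (s + 1) := by
  have hlow : ∀ c r, 0 ≤ c → c ≤ C → 0 ≤ r → c + r = 2 * s + 2 → 2 * i < r - c → ¬ Y c r :=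
    fun c r hc => h.lower_not_mem hi hcol hb c.toNat c r (by omega)
  have hmem := h.even_mem his hb
  -- Squares are forced upwards, starting at the lowest point of the band.
  have hsq : ∀ n : ℕ, ∀ c r : ℤ, c = s + 1 - i + n → c ≤ C → c + r = 2 * s + 2 → c - r ≤ 2 * i →
      S c r := by
    intro n
    induction n with
    | zero =>
      intro c r hc hcC hs hd
      have hc' : c = s + 1 - i := by simpa using hc
      obtain ⟨hNW, hY⟩ := hmem c r (by omega) hcC (by omega) hs hd (by omega)
      have hB : Y c (r + 1) := by
        have h1 := h.altH (c - 1) (r + 1) (by omega) (by omega) (by omega) (by omega) (by omega)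
        have h2 := hlow (c - 1) (r + 1) (by omega) (by omega) (by omega) (by omega) (by omega)
        simpa [h2] using h1
      rcases h.covV c r hY hB with h1 | h1
      · exact h1
      · exact absurd hNW (h.exH (c - 1) r (by omega) (by omega) (by omega) (by omega) (by omega) h1)
    | succ n ih =>
      intro c r hc hcC hs hd
      push_cast at hc
      have hu := ih (c - 1) (r + 1) (by omega) (by omega) (by omega) (by omega)
      have hY := (hmem c r (by omega) hcC (by omega) hs hd (by omega)).2
      have hB := (h.full _ _ hu).2.1
      rcases h.covV c r hY (by simpa using hB) with h1 | h1
      · exact h1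
      · exact absurd (by simpa using h1)
          (h.exH (c - 1) (r + 1) (by omega) (by omega) (by omega) (by omega) (by omega) hu)
  have hsq' : ∀ c r, 0 ≤ c → c ≤ C → 0 ≤ r → c + r = 2 * s + 2 → c - r ≤ 2 * i →
      r - c ≤ 2 * i → S c r := fun c r hc hcC hr hs h1 h2 =>
    hsq (c - (s + 1 - i)).toNat c r (by omega) hcC hs h1
  -- Above the band, the squares of the new antidiagonal block the only possible cover.
  have hup : ∀ n : ℕ, ∀ c r, c ≤ C → 0 ≤ r → c + r = 2 * s + 2 → c - r = 2 * i + 2 + 2 * n →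
      ¬ Y c r := by
    intro n
    induction n with
    | zero =>
      intro c r hcC hr hs hd hY
      have hW := hb.odd (c - 1) r (by omega) (by omega) hr (h.rows _ _ hY).2 (by omega)
      rcases h.covH (c - 1) r hW (by simpa using hY) with h1 | h1
      · have h2 := hsq' (c - 1) (r + 1) (by omega) (by omega) (by omega) (by omega) (by omega)
          (by omega)
        exact h.exH (c - 1) (r + 1) (by omega) (by omega) (by omega) (by omega) (by omega) h2
          (by simpa using h1)
      · have h2 := (h.full _ _ h1).1
        have h3 := (h.rows _ _ h2).1
        have := (hb.even (c - 1) (r - 1) (by omega) (by omega) (by omega) (by omega)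
          (by omega)).1 h2
        omega
    | succ n ih =>
      intro c r hcC hr hs hd hY
      push_cast at hd
      have hW := hb.odd (c - 1) r (by omega) (by omega) hr (h.rows _ _ hY).2 (by omega)
      rcases h.covH (c - 1) r hW (by simpa using hY) with h1 | h1
      · exact ih (c - 1) (r + 1) (by omega) (by omega) (by omega) (by omega) (h.full _ _ h1).2.2.1
      · have h2 := (h.full _ _ h1).1
        have h3 := (h.rows _ _ h2).1
        have := (hb.even (c - 1) (r - 1) (by omega) (by omega) (by omega) (by omega)
          (by omega)).1 h2
        omega
  have heven : ∀ c r, 0 ≤ c → c ≤ C → 0 ≤ r → r ≤ 2 * m + 1 → c + r = 2 * (s + 1) →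
      (Y c r ↔ c - r ≤ 2 * i ∧ r - c ≤ 2 * i) := by
    intro c r hc hcC hr hrP hs
    refine ⟨fun hY => ⟨?_, ?_⟩, fun h1 => (hmem c r hc hcC hr (by omega) h1.1 h1.2).2⟩
    · by_contra hcon
      exact hup ((c - r - 2 * i - 2) / 2).toNat c r hcC hr (by omega) (by omega) hY
    · by_contra hcon
      exact hlow c r hc hcC hr (by omega) (by omega) hY
  refine ⟨heven, fun c r hc hcC hr hs => hsq' c r hc hcC hr (by omega),
    fun c r hc hcC hr hrP hs => ?_⟩
  rcases eq_or_lt_of_le hc with rfl | hc1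
  · exact (hcol r (by omega) hrP).2 (by omega)
  · rcases h.altH (c - 1) r (by omega) (by omega) hr hrP (by omega) with h1 | h1
    · obtain ⟨h2, h3⟩ := (heven (c - 1) r (by omega) (by omega) hr hrP (by omega)).1 h1
      simpa using
        (h.full _ _ (hsq' (c - 1) r (by omega) (by omega) hr (by omega) h2 h3)).2.1
    · simpa using h1

theorem band (h : StripRigid m C t Y S) (hi : 0 ≤ i) (his : i ≤ s)
    (hcol : ∀ r, 2 * i < r → r ≤ 2 * m + 1 → (Y 0 r ↔ r % 2 = 1))
    (hts : t ≤ 2 * s + 1) (hb : BandAt m i C Y S s) (x : ℤ) (hsx : s ≤ x)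
    (hxm : x ≤ 2 * m - i) : BandAt m i C Y S x := by
  induction x, hsx using Int.leInduction with
  | base => exact hb
  | succ x hsx ih =>
    exact h.band_succ hi (by omega) hcol (by omega) (by omega) (ih (by omega))

/-- Once the band reaches the last row, the remaining triangle is a checkerboard whose points of
even coordinate sum are those of `Y`. -/
theorem bottom (h : StripRigid m C t Y S) (him : i ≤ m) (ht : t ≤ 2 * m + 1)
    (hb : BandAt m i C Y S (2 * m - i)) (n : ℕ) (s : ℤ) (hn : s = 2 * m + 1 - i + n) :
    (∀ c r, c ≤ C → c ≤ 2 * m + 1 → r ≤ 2 * m + 1 → c + r = 2 * s → Y c r) ∧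
    (∀ c r, c ≤ C → c ≤ 2 * m + 1 → r ≤ 2 * m + 1 → c + r = 2 * s + 1 → ¬ Y c r) := by
  have hbot : ∀ s, 2 * m + 1 - i ≤ s →
      (∀ c r, c ≤ C → c ≤ 2 * m + 1 → r ≤ 2 * m + 1 → c + r = 2 * s → Y c r) →
      (∀ c r, c ≤ C → c ≤ 2 * m + 1 → r ≤ 2 * m + 1 → c + r = 2 * s + 1 →
        ¬ S (c - 1) (r - 1)) →
      (∀ c r, c ≤ C → c ≤ 2 * m + 1 → r ≤ 2 * m + 1 → c + r = 2 * s + 1 → ¬ Y c r) := by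
    intro s hs hA hB
    have key : ∀ k : ℕ, ∀ c r : ℤ, r = 2 * m + 1 - k → c ≤ C → c ≤ 2 * m + 1 →
        c + r = 2 * s + 1 → ¬ Y c r := by
      intro k
      induction k with
      | zero =>
        intro c r hr hcC hcP hs' hY
        have hW := hA (c - 1) r (by omega) (by omega) (by omega) (by omega)
        rcases h.covH (c - 1) r hW (by simpa using hY) with h1 | h1
        · have := (h.rows _ _ (h.full _ _ h1).2.2.1).2
          push_cast at hr
          omega
        · exact hB c r hcC hcP (by omega) hs' h1
      | succ k ih =>
        intro c r hr hcC hcP hs' hY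
        push_cast at hr
        have hW := hA (c - 1) r (by omega) (by omega) (by omega) (by omega)
        rcases h.covH (c - 1) r hW (by simpa using hY) with h1 | h1
        · exact ih (c - 1) (r + 1) (by omega) (by omega) (by omega) (by omega)
            (h.full _ _ h1).2.2.1
        · exact hB c r hcC hcP (by omega) hs' h1
    exact fun c r hcC hcP hrP => key (2 * m + 1 - r).toNat c r (by omega) hcC hcP
  induction n generalizing s with
  | zero =>
    have hs : s = 2 * m + 1 - i := by simpa using hn
    have hA : ∀ c r, c ≤ C → c ≤ 2 * m + 1 → r ≤ 2 * m + 1 → c + r = 2 * s → Y c r :=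
      fun c r hcC hcP hrP hs' => (h.even_mem (by omega) hb c r (by omega) hcC (by omega)
        (by omega) (by omega) (by omega)).2
    refine ⟨hA, hbot s (by omega) hA fun c r hcC hcP hrP hs' hS => ?_⟩
    refine h.exH (c - 1) (r - 1) (by omega) (by omega) (by omega) (by omega) (by omega) hS ?_
    exact hb.square _ _ (by omega) (by omega) (by omega) (by omega) (by omega) (by omega)
  | succ n ih =>
    push_cast at hn
    obtain ⟨ihA, ihB⟩ := ih (s - 1) (by omega)
    have hA : ∀ c r, c ≤ C → c ≤ 2 * m + 1 → r ≤ 2 * m + 1 → c + r = 2 * s → Y c r := by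
      intro c r hcC hcP hrP hs'
      have h1 := h.altH (c - 1) r (by omega) (by omega) (by omega) hrP (by omega)
      have h2 := ihB (c - 1) r (by omega) (by omega) hrP (by omega)
      simpa [h2] using h1
    exact ⟨hA, hbot s (by omega) hA fun c r hcC hcP hrP hs' hS =>
      ihB (c - 1) (r - 1) (by omega) (by omega) (by omega) (by omega) (h.full _ _ hS).1⟩

/-- A band of squares that has reached the antidiagonal `c + r = 2 * s` continues through a whole
block. -/
theorem blockShape (h : StripRigid m C t Y S) (hi : 0 ≤ i) (him : i ≤ m) (his : i ≤ s)
    (hsm : s ≤ 2 * m - i) (hts : t ≤ 2 * s + 1) (ht : t ≤ 2 * m + 1)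
    (hcol : ∀ r, 2 * i < r → r ≤ 2 * m + 1 → (Y 0 r ↔ r % 2 = 1))
    (hb : ∀ x, i ≤ x → x ≤ s → BandAt m i C Y S x)
    (htop : ∀ c r, 0 ≤ c → c ≤ C → 0 ≤ r → c + r ≤ 2 * i → (Y c r ↔ (c + r) % 2 = 0)) :
    BlockShape m i C Y S := by
  have hband : ∀ x, i ≤ x → x ≤ 2 * m - i → BandAt m i C Y S x := by
    intro x hx hxm
    rcases le_total x s with h1 | h1
    · exact hb x hx h1
    · exact h.band hi his hcol hts (hb s his le_rfl) x h1 hxm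
  have hbot := h.bottom him ht (hband (2 * m - i) (by omega) le_rfl)
  refine ⟨fun c r hc hcC hcP hr hrP => ?_, fun c r hc hcC hr h2 h3 h4 h5 h6 => ?_⟩
  · unfold Aligned
    by_cases h1 : c + r ≤ 2 * i
    · rw [htop c r hc hcC hr h1]
      omega
    by_cases h2 : 4 * m + 2 - 2 * i ≤ c + r
    · obtain ⟨hA, hB⟩ := hbot ((c + r) / 2 - (2 * m + 1 - i)).toNat ((c + r) / 2) (by omega)
      by_cases h3 : (c + r) % 2 = 0
      · have := hA c r hcC hcP hrP (by omega)
        simp only [this, true_iff]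
        omega
      · have := hB c r hcC hcP hrP (by omega)
        simp only [this, false_iff]
        omega
    · by_cases h3 : (c + r) % 2 = 0
      · rw [(hband ((c + r) / 2) (by omega) (by omega)).even c r hc hcC hr hrP (by omega)]
        omega
      · have := (hband ((c + r) / 2) (by omega) (by omega)).odd c r hc hcC hr hrP (by omega)
        simp only [this, true_iff]
        omega
  · exact (hband ((c + r) / 2) (by omega) (by omega)).square c r hc hcC hr (by omega) h5 h6

/-- All squares of a block lie in its band. -/
theorem square_imp (h : StripRigid m C t Y S) (hb : BlockShape m i C Y S) (c r : ℤ)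
    (hc : 0 ≤ c) (hcC : c < C) (hcP : c ≤ 2 * m) (hct : t ≤ c + r + 1) (hS : S c r) :
    (c + r) % 2 = 0 ∧ 2 * i ≤ c + r ∧ c + r ≤ 4 * m - 2 * i ∧ c - r ≤ 2 * i ∧ r - c ≤ 2 * i := by
  obtain ⟨h1, h2, h3, h4⟩ := h.full c r hS
  have hr := (h.rows _ _ h1).1
  have hr' := (h.rows _ _ h3).2
  rw [hb.vertex c r hc (by omega) (by omega) hr (by omega)] at h1
  rw [hb.vertex (c + 1) r (by omega) (by omega) (by omega) hr (by omega)] at h2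
  rw [hb.vertex c (r + 1) (by omega) (by omega) (by omega) (by omega) (by omega)] at h3
  rw [hb.vertex (c + 1) (r + 1) (by omega) (by omega) (by omega) (by omega) (by omega)] at h4
  unfold Aligned at h1 h2 h3 h4
  by_cases hpar : (c + r) % 2 = 0
  · omega
  · have := hb.square c (r + 1) hc (by omega) (by omega) (by omega) (by omega) (by omega) (by omega)
      (by omega)
    exact absurd (by simpa using hS)
      (h.exH c (r + 1) hc hcC (by omega) (by omega) (by omega) this)

/-- A column that can be the first column of a block with parameter `i`: down to row `2 * i` the
even rows belong to `Y`, below it the odd rows. -/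
def StartColumn (m i c : ℤ) (Y : ℤ → ℤ → Prop) : Prop :=
  ∀ r, 0 ≤ r → r ≤ 2 * m + 1 → (Y c r ↔ (r % 2 = 0 ↔ r ≤ 2 * i))

/-- If the two adjacent `Y`-vertices of a start column are joined by a square to the right, then a
block starts there. -/
theorem blockShape_of_startColumn (h : StripRigid m C 0 Y S) (hi : 0 ≤ i) (him : i ≤ m)
    (hcol : StartColumn m i 0 Y) (hS : S 0 (2 * i)) : BlockShape m i C Y S := by
  have htop : ∀ n : ℕ, ∀ c r : ℤ, c = n → c ≤ C → 0 ≤ r → c + r ≤ 2 * i →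
      (Y c r ↔ (c + r) % 2 = 0) := by
    intro n
    induction n with
    | zero =>
      intro c r hc hcC hr hs
      have hc' : c = 0 := by simpa using hc
      subst hc'
      rw [hcol r hr (by omega)]
      omega
    | succ n ih =>
      intro c r hc hcC hr hs
      push_cast at hc
      have hW := ih (c - 1) r (by omega) (by omega) hr (by omega)
      by_cases hpar : (c + r) % 2 = 0
      · have h1 := h.altH (c - 1) r (by omega) (by omega) hr (by omega) (by omega)
        have h2 : ¬ Y (c - 1) r := by rw [hW]; omega
        simpa [h2, hpar] using h1
      · refine iff_of_false (fun hY => ?_) hpar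
        have h2 : Y (c - 1) r := by rw [hW]; omega
        rcases h.covH (c - 1) r h2 (by simpa using hY) with h1 | h1
        · have := (ih (c - 1) (r + 1) (by omega) (by omega) (by omega) (by omega)).1
            (h.full _ _ h1).2.2.1
          omega
        · have h3 := (h.full _ _ h1).1
          have := (ih (c - 1) (r - 1) (by omega) (by omega) (h.rows _ _ h3).1 (by omega)).1 h3
          omega
  have htop' : ∀ c r, 0 ≤ c → c ≤ C → 0 ≤ r → c + r ≤ 2 * i → (Y c r ↔ (c + r) % 2 = 0) :=
    fun c r hc => htop c.toNat c r (by omega)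
  have hleg : ∀ n : ℕ, ∀ c r : ℤ, c = n → c ≤ C → 0 ≤ r → c + r = 2 * i → S c r := by
    intro n
    induction n with
    | zero =>
      intro c r hc hcC hr hs
      have hc' : c = 0 := by simpa using hc
      subst hc'
      obtain rfl : r = 2 * i := by omega
      exact hS
    | succ n ih =>
      intro c r hc hcC hr hs
      push_cast at hc
      have hu := ih (c - 1) (r + 1) (by omega) (by omega) (by omega) (by omega)
      have hY : Y c r := (htop' c r (by omega) hcC hr (by omega)).2 (by omega)
      rcases h.covV c r hY (by simpa using (h.full _ _ hu).2.1) with h1 | h1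
      · exact h1
      · exact absurd (by simpa using h1)
          (h.exH (c - 1) (r + 1) (by omega) (by omega) (by omega) (by omega) (by omega) hu)
  have hleg' : ∀ c r, 0 ≤ c → c ≤ C → 0 ≤ r → c + r = 2 * i → S c r :=
    fun c r hc => hleg c.toNat c r (by omega)
  refine h.blockShape (s := i) hi him le_rfl (by omega) (by omega) (by omega)
    (fun r h1 h2 => ?_) (fun x h1 h2 => ?_) htop'
  · rw [hcol r (by omega) h2]
    omega
  · obtain rfl : x = i := by omega
    refine ⟨fun c r hc hcC hr hrP hs => ?_, fun c r hc hcC hr hs _ _ => hleg' c r hc hcC hr hs,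
      fun c r hc hcC hr hrP hs => ?_⟩
    · rw [htop' c r hc hcC hr (by omega)]
      omega
    · rcases eq_or_lt_of_le hc with rfl | hc1
      · rw [hcol r hr hrP]
        omega
      · simpa using (h.full _ _ (hleg' (c - 1) r (by omega) (by omega) hr (by omega))).2.1

/-- If the square at the head of a start column is missing, then this column and the next one carry
no squares, and the column after them is again a start column, now with its square. -/
theorem flat (h : StripRigid m C 0 Y S) (hi : 0 ≤ i) (him : i ≤ m)
    (hcol : StartColumn m i 0 Y) (hS : ¬ S 0 (2 * i)) (hC : 1 ≤ C) :
    (∀ r, ¬ S 0 r) ∧ (∀ r, ¬ S 1 r) ∧ (2 ≤ C → StartColumn m i 2 Y ∧ S 2 (2 * i)) := by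
  have hno : ∀ r, ¬ S 0 r := by
    intro r hr
    obtain ⟨h1, -, h2, -⟩ := h.full _ _ hr
    have hr0 := (h.rows _ _ h1).1
    have hrP := (h.rows _ _ h2).2
    rw [hcol r hr0 (by omega)] at h1
    rw [hcol (r + 1) (by omega) hrP] at h2
    obtain rfl : r = 2 * i := by omega
    exact hS hr
  have hnext : ∀ c, 0 ≤ c → c < C → (∀ r, ¬ S c r) → ∀ r, 0 ≤ r → r ≤ 2 * m + 1 →
      (Y (c + 1) r ↔ ¬ Y c r) := by
    intro c hc hcC hn r hr hrP
    constructor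
    · intro h1 h2
      rcases h.covH c r h2 h1 with h3 | h3
      exacts [hn _ h3, hn _ h3]
    · intro h1
      exact (h.altH c r hc hcC hr hrP (by omega)).resolve_left h1
  have hcol1 := hnext 0 le_rfl (by omega) hno
  simp only [zero_add] at hcol1
  have hno1 : ∀ r, ¬ S 1 r := by
    intro r hr
    obtain ⟨h1, -, h2, -⟩ := h.full _ _ hr
    have hr0 := (h.rows _ _ h1).1
    have hrP := (h.rows _ _ h2).2
    rw [hcol1 r hr0 (by omega), hcol r hr0 (by omega)] at h1
    rw [hcol1 (r + 1) (by omega) hrP, hcol (r + 1) (by omega) hrP] at h2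
    omega
  refine ⟨hno, hno1, fun hC2 => ?_⟩
  have hcol2 := hnext 1 (by omega) (by omega) hno1
  norm_num at hcol2
  have hs : StartColumn m i 2 Y := by
    intro r hr hrP
    rw [hcol2 r hr hrP, hcol1 r hr hrP, not_not, hcol r hr hrP]
  refine ⟨hs, ?_⟩
  rcases h.covV 2 (2 * i) ((hs _ (by omega) (by omega)).2 (by omega))
    ((hs _ (by omega) (by omega)).2 (by omega)) with h1 | h1
  · exact h1
  · exact absurd (by simpa using h1) (hno1 (2 * i))

end StripRigid

/-! ### Sequences of blocks -/

/-- A column of a block, read from the left (parameter `i`, column `t`) and from the right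
(parameter `j`, column `m`, rows reversed), determines `t`, provided that the square
`(t - 1, m)` lies in the band of parameter `i`. In each case the rows used are those where the
two patterns change. -/
theorem aligned_match {m i j t : ℤ} (hi : 0 ≤ i) (him : i ≤ m) (hj : 0 ≤ j) (hjm : j ≤ m)
    (h1 : (t - 1 + m) % 2 = 0) (h2 : 2 * i ≤ t - 1 + m) (h3 : t - 1 + m ≤ 4 * m - 2 * i)
    (h4 : t - 1 - m ≤ 2 * i) (h5 : m - (t - 1) ≤ 2 * i)
    (H : ∀ r, 0 ≤ r → r ≤ 2 * m + 1 → (Aligned m i t r ↔ Aligned m j m (2 * m + 1 - r))) :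
    t = m + 1 := by
  unfold Aligned at H
  by_contra hne
  rcases lt_or_gt_of_ne hne with hlt | hlt
  · rcases lt_or_ge (2 * i) (t - 1) with h6 | h6
    · have a1 := H (t - 1 - 2 * i + 1)
      have a2 := H (t - 1 + 2 * i + 3)
      omega
    rcases le_or_gt (t - 1 + 2 * i) (2 * m) with h7 | h7
    · rcases lt_trichotomy (2 * i - t) (2 * j - m - 1) with h8 | h8 | h8
      · have a1 := H (2 * i - (t - 1))
        have a2 := H (2 * m + 1)
        clear H
        omega
      · have a1 := H (2 * m + 1)
        have a2 := H (t - 1 + 2 * i)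
        clear H
        omega
      · have a1 := H (2 * i - (t - 1) - 2)
        have a2 := H (2 * i - (t - 1) - 1)
        have a3 := H (2 * i - (t - 1) + 1)
        clear H
        omega
    · have a1 := H (2 * i - (t - 1) - 2)
      have a2 := H (4 * m - 2 * i - (t - 1) - 2)
      omega
  · rcases lt_or_ge (2 * i) (t - 1) with h6 | h6
    · rcases le_or_gt (t - 1 + 2 * i) (2 * m) with h7 | h7
      · have a1 := H (t - 1 - 2 * i - 1)
        have a2 := H (t - 1 + 2 * i - 1)
        omega
      · have a1 := H (t - 1 - 2 * i - 1)
        have a2 := H (4 * m - 2 * i - (t - 1) + 2)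
        omega
    · have a1 := H (2 * i - (t - 1))
      have a2 := H (4 * m - 2 * i - (t - 1) + 2)
      omega

/-- The column `C`, which has distance `m` from the right end of the grid, as seen from the right.
The description is chosen with the rows reversed or not according to the parity of `C + m`; both
are available by symmetry, and this choice is stable under passing to the next block. -/
def RightColumn (m C : ℤ) (Y : ℤ → ℤ → Prop) : Prop :=
  ∃ j, 0 ≤ j ∧ j ≤ m ∧
    ((C + m) % 2 = 1 → ∀ r, 0 ≤ r → r ≤ 2 * m + 1 →
      (Y C r ↔ ((m + (2 * m + 1 - r)) % 2 = 0 ↔ Aligned m j m (2 * m + 1 - r)))) ∧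
    ((C + m) % 2 = 0 → ∀ r, 0 ≤ r → r ≤ 2 * m + 1 →
      (Y C r ↔ ((m + r) % 2 = 0 ↔ Aligned m j m r)))

namespace StripRigid

variable {m i C t : ℤ} {Y S : ℤ → ℤ → Prop}

/-- The strip as seen from the last column of its first block, with the rows reversed. -/
theorem shift_flip (h : StripRigid m C t Y S) (ht : t ≤ 2 * m + 1) :
    StripRigid m (C - (2 * m + 1)) 0 (fun c r => Y (2 * m + 1 + c) (2 * m + 1 - r))
      (fun c r => S (2 * m + 1 + c) (2 * m - r)) where
  rows c r hY := by
    have := h.rows _ _ hY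
    omega
  full c r hS := by
    obtain ⟨h1, h2, h3, h4⟩ := h.full _ _ hS
    refine ⟨?_, ?_, ?_, ?_⟩
    · convert h3 using 1; ring
    · convert h4 using 1 <;> ring
    · convert h1 using 1; ring
    · convert h2 using 1 <;> ring
  covH c r h1 h2 := by
    rcases h.covH (2 * m + 1 + c) (2 * m + 1 - r) h1 (by convert h2 using 1; ring) with h3 | h3
    · right
      convert h3 using 1; ring
    · left
      convert h3 using 1; ring
  covV c r h1 h2 := by
    rcases h.covV (2 * m + 1 + c) (2 * m - r) (by convert h2 using 1; ring)
      (by convert h1 using 1; ring) with h3 | h3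
    · exact Or.inl h3
    · right
      convert h3 using 1; ring
  exH c r hc hcC hr hrP _ h1 h2 := by
    refine h.exH (2 * m + 1 + c) (2 * m + 1 - r) (by omega) (by omega) (by omega) (by omega)
      (by omega) ?_ ?_
    · convert h2 using 1; ring
    · convert h1 using 1; ring
  altH c r hc hcC hr hrP _ := by
    have := h.altH (2 * m + 1 + c) (2 * m + 1 - r) (by omega) (by omega) (by omega) (by omega)
      (by omega)
    rwa [add_assoc (2 * m + 1)] at this

/-- The strip without its first two columns. -/
theorem shift_two (h : StripRigid m C 0 Y S) :
    StripRigid m (C - 2) 0 (fun c r => Y (2 + c) r) (fun c r => S (2 + c) r) where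
  rows c r hY := h.rows _ _ hY
  full c r hS := by simpa only [add_assoc] using h.full _ _ hS
  covH c r h1 h2 := h.covH _ _ h1 (by rwa [add_assoc])
  covV c r h1 h2 := by
    rw [add_sub_assoc']
    exact h.covV _ _ h1 h2
  exH c r hc hcC hr hrP _ := h.exH _ _ (by omega) (by omega) hr hrP (by omega)
  altH c r hc hcC hr hrP _ := by
    rw [← add_assoc]
    exact h.altH _ _ (by omega) (by omega) hr hrP (by omega)

/-- If the strip ends within the first block, the forced square `(C - 1, m)` fixes its width. -/
theorem width_eq_of_le (h : StripRigid m C t Y S) (hi : 0 ≤ i) (him : i ≤ m) (hC : 1 ≤ C)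
    (hCP : C ≤ 2 * m + 1) (ht : t ≤ C + m) (hb : BlockShape m i C Y S) (hS : S (C - 1) m)
    (hR : RightColumn m C Y) : C = m + 1 := by
  obtain ⟨h1, h2, h3, h4, h5⟩ := h.square_imp hb (C - 1) m (by omega) (by omega) (by omega)
    (by omega) hS
  obtain ⟨j, hj, hjm, hR, -⟩ := hR
  refine aligned_match hi him hj hjm h1 h2 h3 h4 h5 fun r hr hrP => ?_
  have h6 := hR (by omega) r hr hrP
  rw [hb.vertex C r (by omega) le_rfl hCP hr hrP,
    show (C + r) % 2 = 0 ↔ (m + (2 * m + 1 - r)) % 2 = 0 by omega] at h6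
  by_cases hp : (m + (2 * m + 1 - r)) % 2 = 0 <;> simp only [hp, true_iff, false_iff] at h6
  · exact h6
  · exact not_iff_not.1 h6

/-- The strip is a sequence of blocks, with consecutive blocks separated by at most one pair of
columns without squares. Here `k` counts the complete blocks and `l` the pairs. -/
theorem width_eq (n : ℕ) : ∀ {C i t : ℤ} {Y S : ℤ → ℤ → Prop}, StripRigid m C t Y S → C ≤ n →
    1 ≤ C → 0 ≤ i → i ≤ m → t ≤ 2 * m + 1 → t ≤ C + m → BlockShape m i C Y S → S (C - 1) m →
    RightColumn m C Y → ∃ k l : ℤ, 0 ≤ l ∧ l ≤ k ∧ C = m + 1 + k * (2 * m + 1) + 2 * l := by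
  induction n with
  | zero =>
    intro C i t Y S h hCn hC
    push_cast at hCn
    omega
  | succ n ih =>
    intro C i t Y S h hCn hC hi him ht htC hb hS hR
    rcases le_or_gt C (2 * m + 1) with hCP | hCP
    · exact ⟨0, 0, le_rfl, le_rfl, by
        have := h.width_eq_of_le hi him hC hCP htC hb hS hR
        omega⟩
    push_cast at hCn
    have h' := h.shift_flip ht
    have hcol : StartColumn m i 0 (fun c r => Y (2 * m + 1 + c) (2 * m + 1 - r)) := by
      intro r hr hrP
      simp only [add_zero]
      rw [hb.vertex _ _ (by omega) hCP.le le_rfl (by omega) (by omega)]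
      unfold Aligned
      omega
    have hS' : S (2 * m + 1 + (C - (2 * m + 1) - 1)) (2 * m - m) := by
      convert hS using 1 <;> ring
    have hR' : RightColumn m (C - (2 * m + 1))
        (fun c r => Y (2 * m + 1 + c) (2 * m + 1 - r)) := by
      obtain ⟨j, hj, hjm, h1, h2⟩ := hR
      refine ⟨j, hj, hjm, fun hp r hr hrP => ?_, fun hp r hr hrP => ?_⟩
      · simpa using h2 (by omega) (2 * m + 1 - r) (by omega) (by omega)
      · simpa using h1 (by omega) (2 * m + 1 - r) (by omega) (by omega)
    by_cases hap : S (2 * m + 1 + 0) (2 * m - 2 * i)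
    · have hb' := h'.blockShape_of_startColumn hi him hcol hap
      obtain ⟨k, l, hl, hlk, hkl⟩ := ih h' (by omega) (by omega) hi him (by omega) (by omega) hb'
        hS' hR'
      exact ⟨k + 1, l, hl, by omega, by linear_combination hkl⟩
    · obtain ⟨h0, h1, h2⟩ := h'.flat hi him hcol hap (by omega)
      -- The square `(C - 1, m)` cannot lie in the two columns without squares.
      have hC3 : 3 ≤ C - (2 * m + 1) := by
        by_contra hcon
        obtain hc | hc : C - (2 * m + 1) = 1 ∨ C - (2 * m + 1) = 2 := by omega
        · exact h0 m (by rwa [hc] at hS')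
        · exact h1 m (by rwa [hc] at hS')
      obtain ⟨hcol2, hap2⟩ := h2 (by omega)
      have hb' := h'.shift_two.blockShape_of_startColumn hi him hcol2 hap2
      obtain ⟨k, l, hl, hlk, hkl⟩ := ih h'.shift_two (by omega) (by omega) hi him (by omega)
        (by omega) hb' (by convert hS using 1 <;> ring) (by
          obtain ⟨j, hj, hjm, h1, h2⟩ := hR'
          refine ⟨j, hj, hjm, fun hp r hr hrP => ?_, fun hp r hr hrP => ?_⟩
          · rw [← h1 (by omega) r hr hrP]
            ring_nf
          · rw [← h2 (by omega) r hr hrP]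
            ring_nf)
      exact ⟨k + 1, l + 1, by omega, by omega, by linear_combination hkl⟩

end StripRigid

/-! ### Covers attaining the ring bound -/

/-- The edge from `(c, r)` to `(c + 1, r)` of the `p × q` grid is a ring edge: it lies on one of the
concentric rectangles around the grid, that is, both of its ends are at least as far from the left
and right sides as the row `r` is from the nearer of the top and bottom sides. A vertical edge from
`(c, r)` to `(c, r + 1)` is a ring edge if `RingEdge p q r c`. -/
def RingEdge (q p c r : ℤ) : Prop :=
  0 ≤ c ∧ c + 1 < q ∧ 0 ≤ r ∧ r < p ∧ (r ≤ c ∨ p - 1 - r ≤ c) ∧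
    (r ≤ q - 2 - c ∨ p - 1 - r ≤ q - 2 - c)

/-- The properties of a cover of the grid with `2 * m + 2` rows and `q` columns that attains the
ring bound: squares contain no star centres, every ring edge is covered exactly once, and the two
squares at the ends of the innermost ring are used. Notation as in `CornerRigid`. -/
structure RigidCover (m q : ℤ) (Y S : ℤ → ℤ → Prop) : Prop where
  dom : ∀ c r, Y c r → 0 ≤ c ∧ c < q ∧ 0 ≤ r ∧ r < 2 * m + 2
  full : ∀ c r, S c r → Y c r ∧ Y (c + 1) r ∧ Y c (r + 1) ∧ Y (c + 1) (r + 1)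
  covH : ∀ c r, Y c r → Y (c + 1) r → S c r ∨ S c (r - 1)
  covV : ∀ c r, Y c r → Y c (r + 1) → S c r ∨ S (c - 1) r
  exH : ∀ c r, RingEdge q (2 * m + 2) c r → S c r → ¬ S c (r - 1)
  altH : ∀ c r, RingEdge q (2 * m + 2) c r → Y c r ∨ Y (c + 1) r
  exV : ∀ c r, RingEdge (2 * m + 2) q r c → S c r → ¬ S (c - 1) r
  altV : ∀ c r, RingEdge (2 * m + 2) q r c → Y c r ∨ Y c (r + 1)
  left : S m m
  right : S (q - 2 - m) m

namespace RigidCover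

variable {m q : ℤ} {Y S : ℤ → ℤ → Prop}

theorem reflect (h : RigidCover m q Y S) :
    RigidCover m q (fun c r => Y (q - 1 - c) r) (fun c r => S (q - 2 - c) r) where
  dom c r hY := by
    have := h.dom _ _ hY
    omega
  full c r hS := by
    obtain ⟨h1, h2, h3, h4⟩ := h.full _ _ hS
    rw [show q - 2 - c + 1 = q - 1 - c by ring] at h2 h4
    rw [show q - 1 - (c + 1) = q - 2 - c by ring]
    exact ⟨h2, h1, h4, h3⟩
  covH c r h1 h2 := by
    rw [show q - 1 - (c + 1) = q - 2 - c by ring] at h2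
    exact h.covH (q - 2 - c) r h2 (by convert h1 using 1; ring)
  covV c r h1 h2 := by
    rw [show q - 2 - (c - 1) = q - 1 - c by ring, show q - 2 - c = q - 1 - c - 1 by ring]
    exact (h.covV _ _ h1 h2).symm
  exH c r he := h.exH _ _ (by unfold RingEdge at *; omega)
  altH c r he := by
    have := h.altH (q - 2 - c) r (by unfold RingEdge at *; omega)
    rw [show q - 2 - c + 1 = q - 1 - c by ring] at this
    rw [show q - 1 - (c + 1) = q - 2 - c by ring]
    exact this.symm
  exV c r he h1 h2 := by
    rw [show q - 2 - (c - 1) = q - 1 - c by ring] at h2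
    rw [show q - 2 - c = q - 1 - c - 1 by ring] at h1
    exact h.exV (q - 1 - c) r (by unfold RingEdge at *; omega) h2 h1
  altV c r he := h.altV _ _ (by unfold RingEdge at *; omega)
  left := h.right
  right := by simpa using h.left

theorem flip (h : RigidCover m q Y S) :
    RigidCover m q (fun c r => Y c (2 * m + 1 - r)) (fun c r => S c (2 * m - r)) where
  dom c r hY := by
    have := h.dom _ _ hY
    omega
  full c r hS := by
    obtain ⟨h1, h2, h3, h4⟩ := h.full _ _ hS
    rw [show 2 * m - r + 1 = 2 * m + 1 - r by ring] at h3 h4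
    rw [show 2 * m + 1 - (r + 1) = 2 * m - r by ring]
    exact ⟨h3, h4, h1, h2⟩
  covH c r h1 h2 := by
    rw [show 2 * m - (r - 1) = 2 * m + 1 - r by ring, show 2 * m - r = 2 * m + 1 - r - 1 by ring]
    exact (h.covH _ _ h1 h2).symm
  covV c r h1 h2 := by
    rw [show 2 * m + 1 - (r + 1) = 2 * m - r by ring] at h2
    exact h.covV c (2 * m - r) h2 (by convert h1 using 1; ring)
  exH c r he h1 h2 := by
    rw [show 2 * m - (r - 1) = 2 * m + 1 - r by ring] at h2
    rw [show 2 * m - r = 2 * m + 1 - r - 1 by ring] at h1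
    exact h.exH c (2 * m + 1 - r) (by unfold RingEdge at *; omega) h2 h1
  altH c r he := h.altH _ _ (by unfold RingEdge at *; omega)
  exV c r he := h.exV _ _ (by unfold RingEdge at *; omega)
  altV c r he := by
    have := h.altV c (2 * m - r) (by unfold RingEdge at *; omega)
    rw [show 2 * m - r + 1 = 2 * m + 1 - r by ring] at this
    rw [show 2 * m + 1 - (r + 1) = 2 * m - r by ring]
    exact this.symm
  left := by convert h.left using 1; ring
  right := by convert h.right using 1; ring

theorem cornerRigid (h : RigidCover m q Y S) (hq : 2 * m + 2 < q) : CornerRigid m Y S where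
  dom c r hY := by
    have := h.dom _ _ hY
    omega
  full := h.full
  covH := h.covH
  covV := h.covV
  exH c r h1 h2 h3 := h.exH _ _ (by unfold RingEdge; omega)
  altH c r h1 h2 h3 := h.altH _ _ (by unfold RingEdge; omega)
  exV c r h1 h2 h3 := h.exV _ _ (by unfold RingEdge; omega)
  altV c r h1 h2 h3 := h.altV _ _ (by unfold RingEdge; omega)
  mid := h.left

theorem stripRigid (h : RigidCover m q Y S) :
    StripRigid m (q - 1 - m) (2 * m + 1) Y S where
  rows c r hY := by
    have := h.dom _ _ hY
    omega
  full := h.full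
  covH := h.covH
  covV := h.covV
  exH c r _ _ _ _ _ := h.exH _ _ (by unfold RingEdge; omega)
  altH c r _ _ _ _ _ := h.altH _ _ (by unfold RingEdge; omega)

theorem exists_blockShape (h : RigidCover m q Y S) (hq : 2 * m + 2 < q) :
    ∃ i, 0 ≤ i ∧ i ≤ m ∧ BlockShape m i (q - 1 - m) Y S := by
  obtain ⟨i, hi, him, htri, heven, hsq, hodd⟩ := (h.cornerRigid hq).shape
  refine ⟨i, hi, him, h.stripRigid.blockShape (s := m) hi him him (by omega) le_rfl le_rfl
    (fun r h1 h2 => ?_) (fun x h1 h2 => ?_) (fun c r hc _ hr hs => htri c r hc hr hs)⟩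
  · by_cases hp : r % 2 = 1
    · simp only [hp, iff_true]
      exact hodd 0 r le_rfl (by omega) (by omega) (by omega) (by omega)
    · rw [heven 0 r le_rfl (by omega) (by omega) (by omega) (by omega)]
      omega
  · exact ⟨fun c r hc _ hr _ hs => heven c r hc hr (by omega) (by omega) (by omega),
      fun c r hc _ hr hs => hsq c r hc hr (by omega) (by omega) (by omega),
      fun c r hc _ hr _ hs => hodd c r hc hr (by omega) (by omega) (by omega)⟩

theorem rightColumn (h : RigidCover m q Y S) (hm : 0 ≤ m) (hq : 2 * m + 2 < q) :
    RightColumn m (q - 1 - m) Y := by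
  by_cases hp : (q - 1 - m + m) % 2 = 1
  · obtain ⟨j, hj, hjm, hb⟩ := h.reflect.flip.exists_blockShape hq
    refine ⟨j, hj, hjm, fun _ r hr hrP => ?_, fun hp' => by omega⟩
    rw [← hb.vertex m (2 * m + 1 - r) hm (by omega) (by omega) (by omega) (by omega)]
    simp
  · obtain ⟨j, hj, hjm, hb⟩ := h.reflect.exists_blockShape hq
    refine ⟨j, hj, hjm, fun hp' => by omega, fun _ r hr hrP => ?_⟩
    rw [← hb.vertex m r hm (by omega) (by omega) (by omega) (by omega)]

/-- A cover attaining the ring bound exists only for the exceptional numbers of columns. -/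
theorem exists_eq (h : RigidCover m q Y S) (hm : 0 ≤ m) (hq : 2 * m + 2 < q) :
    ∃ k l : ℤ, 0 ≤ l ∧ l < k ∧ q - 1 = k * (2 * m + 1) + 2 * l := by
  obtain ⟨i, hi, him, hb⟩ := h.exists_blockShape hq
  obtain ⟨k, l, hl, hlk, hkl⟩ := StripRigid.width_eq (q - 1 - m).toNat h.stripRigid (by omega)
    (by omega) hi him le_rfl (by omega) hb (by convert h.right using 1; ring)
    (h.rightColumn hm hq)
  exact ⟨k + 1, l, hl, by omega, by linear_combination hkl⟩

end RigidCover

/-! ### Double counting of ring edges -/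

instance (q p c r : ℤ) : Decidable (RingEdge q p c r) := by unfold RingEdge; infer_instance

theorem ringEdge_iff {q p c r : ℤ} (hr : 0 ≤ r) (hrp : r < p) :
    RingEdge q p c r ↔ min r (p - 1 - r) ≤ c ∧ min r (p - 1 - r) ≤ q - 2 - c := by
  unfold RingEdge
  omega

/-- With an even number of rows, every vertex lies on exactly two ring edges. -/
theorem ringDegree_even {m q c r : ℤ} (hq : 2 * m + 2 ≤ q) (hc : 0 ≤ c) (hcq : c < q)
    (hr : 0 ≤ r) (hrp : r < 2 * m + 2) :
    (if RingEdge q (2 * m + 2) c r then (1 : ℤ) else 0) +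
      (if RingEdge q (2 * m + 2) (c - 1) r then 1 else 0) +
      (if RingEdge (2 * m + 2) q r c then 1 else 0) +
      (if RingEdge (2 * m + 2) q (r - 1) c then 1 else 0) = 2 := by
  simp only [ringEdge_iff hr hrp, ringEdge_iff hc hcq]
  rcases min_cases r (2 * m + 2 - 1 - r) with ⟨h1, h2⟩ | ⟨h1, h2⟩ <;>
    rcases min_cases c (q - 1 - c) with ⟨h3, h4⟩ | ⟨h3, h4⟩ <;> rw [h1, h3] <;>
    split_ifs <;> omega

/-- With an odd number of rows the innermost ring is a path, whose ends lie on one ring edge less.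
For a single point both indicators apply. -/
theorem ringDegree_odd {m q c r : ℤ} (hq : 2 * m + 1 ≤ q) (hc : 0 ≤ c) (hcq : c < q)
    (hr : 0 ≤ r) (hrp : r < 2 * m + 1) :
    (if RingEdge q (2 * m + 1) c r then (1 : ℤ) else 0) +
      (if RingEdge q (2 * m + 1) (c - 1) r then 1 else 0) +
      (if RingEdge (2 * m + 1) q r c then 1 else 0) +
      (if RingEdge (2 * m + 1) q (r - 1) c then 1 else 0) = 2 - (if c = m ∧ r = m then 1 else 0)
        - (if c = q - 1 - m ∧ r = m then 1 else 0) := by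
  simp only [ringEdge_iff hr hrp, ringEdge_iff hc hcq]
  rcases min_cases r (2 * m + 1 - 1 - r) with ⟨h1, h2⟩ | ⟨h1, h2⟩ <;>
    rcases min_cases c (q - 1 - c) with ⟨h3, h4⟩ | ⟨h3, h4⟩ <;> rw [h1, h3] <;>
    split_ifs <;> omega

/-- A unit square contains at most two ring edges, apart from the two at the ends of the innermost
ring (which coincide when the grid is a square). -/
theorem ringCount_even {m q c r : ℤ} (hq : 2 * m + 2 ≤ q) (hc : 0 ≤ c) (hcq : c + 1 < q)
    (hr : 0 ≤ r) (hrp : r + 1 < 2 * m + 2) :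
    (if RingEdge q (2 * m + 2) c r then (1 : ℤ) else 0) +
      (if RingEdge q (2 * m + 2) c (r + 1) then 1 else 0) +
      (if RingEdge (2 * m + 2) q r c then 1 else 0) +
      (if RingEdge (2 * m + 2) q r (c + 1) then 1 else 0) ≤ 2 + (if c = m ∧ r = m then 1 else 0)
        + (if c = q - 2 - m ∧ r = m then 1 else 0) := by
  unfold RingEdge
  split_ifs <;> first | (norm_num; done) | omega

theorem ringCount_odd {m q c r : ℤ} (hq : 2 * m + 1 ≤ q) (hc : 0 ≤ c) (hcq : c + 1 < q)
    (hr : 0 ≤ r) (hrp : r + 1 < 2 * m + 1) :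
    (if RingEdge q (2 * m + 1) c r then (1 : ℤ) else 0) +
      (if RingEdge q (2 * m + 1) c (r + 1) then 1 else 0) +
      (if RingEdge (2 * m + 1) q r c then 1 else 0) +
      (if RingEdge (2 * m + 1) q r (c + 1) then 1 else 0) ≤ 2 := by
  unfold RingEdge
  split_ifs <;> first | (norm_num; done) | omega

/-- The edges of the `p × q` grid (in integer coordinates: `0 ≤ c < q`, `0 ≤ r < p`) are covered by
the stars with centres in `X` and the unit squares with smallest corner in `S`. -/
structure GridCover (q p : ℤ) (X S : Finset (ℤ × ℤ)) : Prop where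
  vertex : ∀ v ∈ X, 0 ≤ v.1 ∧ v.1 < q ∧ 0 ≤ v.2 ∧ v.2 < p
  square : ∀ s ∈ S, 0 ≤ s.1 ∧ s.1 + 1 < q ∧ 0 ≤ s.2 ∧ s.2 + 1 < p
  covH : ∀ c r, 0 ≤ c → c + 1 < q → 0 ≤ r → r < p →
    (c, r) ∈ X ∨ (c + 1, r) ∈ X ∨ (c, r) ∈ S ∨ (c, r - 1) ∈ S
  covV : ∀ c r, 0 ≤ c → c < q → 0 ≤ r → r + 1 < p →
    (c, r) ∈ X ∨ (c, r + 1) ∈ X ∨ (c, r) ∈ S ∨ (c - 1, r) ∈ S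

/-- The integer-valued indicator function of a finite set of points. -/
def ind (A : Finset (ℤ × ℤ)) (v : ℤ × ℤ) : ℤ := if v ∈ A then 1 else 0

theorem ind_nonneg (A : Finset (ℤ × ℤ)) (v : ℤ × ℤ) : 0 ≤ ind A v := by
  unfold ind
  split_ifs <;> simp

theorem ind_of_mem {A : Finset (ℤ × ℤ)} {v : ℤ × ℤ} (h : v ∈ A) : ind A v = 1 := if_pos h

theorem sum_ite_eq_ind (A : Finset (ℤ × ℤ)) (a b : ℤ) :
    ∑ v ∈ A, (if v.1 = a ∧ v.2 = b then (1 : ℤ) else 0) = ind A (a, b) := by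
  have : ∀ v : ℤ × ℤ, (v.1 = a ∧ v.2 = b) ↔ v = (a, b) := fun v => by
    rw [Prod.ext_iff]
  simp only [this, Finset.sum_ite_eq', ind]

theorem ind_le_one (A : Finset (ℤ × ℤ)) (v : ℤ × ℤ) : ind A v ≤ 1 := by
  unfold ind
  split_ifs <;> simp

theorem sum_ind_add (A B : Finset (ℤ × ℤ)) (d : ℤ × ℤ) :
    ∑ e ∈ A, ind B (e + d) = ∑ b ∈ B, ind A (b - d) := by
  unfold ind
  rw [← Finset.sum_filter, ← Finset.sum_filter, Finset.sum_const, Finset.sum_const]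
  congr 1
  refine Finset.card_nbij' (· + d) (· - d) ?_ ?_ ?_ ?_ <;> intro x hx <;> simp_all

/-- The horizontal ring edges, named by their left ends. -/
noncomputable def ringH (q p : ℤ) : Finset (ℤ × ℤ) :=
  (Finset.Ico 0 q ×ˢ Finset.Ico 0 p).filter fun v => RingEdge q p v.1 v.2

/-- The vertical ring edges, named by their ends with the smaller row. -/
noncomputable def ringV (q p : ℤ) : Finset (ℤ × ℤ) :=
  (Finset.Ico 0 q ×ˢ Finset.Ico 0 p).filter fun v => RingEdge p q v.2 v.1

theorem mem_ringH {q p : ℤ} {v : ℤ × ℤ} : v ∈ ringH q p ↔ RingEdge q p v.1 v.2 := by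
  simp only [ringH, Finset.mem_filter, Finset.mem_product, Finset.mem_Ico, and_iff_right_iff_imp]
  unfold RingEdge
  omega

theorem mem_ringV {q p : ℤ} {v : ℤ × ℤ} : v ∈ ringV q p ↔ RingEdge p q v.2 v.1 := by
  simp only [ringV, Finset.mem_filter, Finset.mem_product, Finset.mem_Ico, and_iff_right_iff_imp]
  unfold RingEdge
  omega

/-- How often the horizontal edge `e` is covered: by the stars centred at its two ends, and by
the squares on both sides. -/
noncomputable def multH (X S : Finset (ℤ × ℤ)) (e : ℤ × ℤ) : ℤ :=
  ind X e + ind X (e + (1, 0)) + ind S e + ind S (e + (0, -1))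

/-- How often the vertical edge `e` is covered. -/
noncomputable def multV (X S : Finset (ℤ × ℤ)) (e : ℤ × ℤ) : ℤ :=
  ind X e + ind X (e + (0, 1)) + ind S e + ind S (e + (-1, 0))

/-- The number of ring edges at the vertex `v`. -/
noncomputable def ringDegree (q p : ℤ) (v : ℤ × ℤ) : ℤ :=
  ind (ringH q p) v + ind (ringH q p) (v - (1, 0)) + ind (ringV q p) v +
    ind (ringV q p) (v - (0, 1))

/-- The number of ring edges of the unit square `s`. -/
noncomputable def ringCount (q p : ℤ) (s : ℤ × ℤ) : ℤ :=
  ind (ringH q p) s + ind (ringH q p) (s - (0, -1)) + ind (ringV q p) s +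
    ind (ringV q p) (s - (-1, 0))

theorem double_count (q p : ℤ) (X S : Finset (ℤ × ℤ)) :
    ∑ e ∈ ringH q p, multH X S e + ∑ e ∈ ringV q p, multV X S e =
      ∑ v ∈ X, ringDegree q p v + ∑ s ∈ S, ringCount q p s := by
  have h0 : ∀ A B : Finset (ℤ × ℤ), ∑ e ∈ A, ind B e = ∑ b ∈ B, ind A b := fun A B => by
    simpa using sum_ind_add A B 0
  simp only [multH, multV, ringDegree, ringCount, Finset.sum_add_distrib, sum_ind_add, h0 _ X,
    h0 _ S]
  ring

theorem ringDegree_eq (q p c r : ℤ) : ringDegree q p (c, r) =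
    (if RingEdge q p c r then (1 : ℤ) else 0) + (if RingEdge q p (c - 1) r then 1 else 0) +
      (if RingEdge p q r c then 1 else 0) + (if RingEdge p q (r - 1) c then 1 else 0) := by
  simp [ringDegree, ind, mem_ringH, mem_ringV]

theorem ringCount_eq (q p c r : ℤ) : ringCount q p (c, r) =
    (if RingEdge q p c r then (1 : ℤ) else 0) + (if RingEdge q p c (r + 1) then 1 else 0) +
      (if RingEdge p q r c then 1 else 0) + (if RingEdge p q r (c + 1) then 1 else 0) := by
  simp [ringCount, ind, mem_ringH, mem_ringV]

/-- The vertices of the `p × q` grid. -/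
noncomputable def gridBox (q p : ℤ) : Finset (ℤ × ℤ) := Finset.Ico 0 q ×ˢ Finset.Ico 0 p

theorem mem_gridBox {q p : ℤ} {v : ℤ × ℤ} :
    v ∈ gridBox q p ↔ 0 ≤ v.1 ∧ v.1 < q ∧ 0 ≤ v.2 ∧ v.2 < p := by
  simp [gridBox, and_assoc]

theorem card_gridBox {q p : ℤ} (hq : 0 ≤ q) (hp : 0 ≤ p) : ((gridBox q p).card : ℤ) = q * p := by
  simp [gridBox, hq, hp]

/-- The handshake lemma for ring edges, as the case of `double_count` where every vertex is a star
centre. -/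
theorem two_mul_card_ring (q p : ℤ) :
    2 * (((ringH q p).card : ℤ) + (ringV q p).card) = ∑ v ∈ gridBox q p, ringDegree q p v := by
  have h := double_count q p (gridBox q p) ∅
  rw [Finset.sum_empty, add_zero] at h
  rw [← h, Finset.sum_congr rfl (g := fun _ => (2 : ℤ)), Finset.sum_congr (s₁ := ringV q p) rfl
    (g := fun _ => (2 : ℤ))]
  · simp
    ring
  · rintro ⟨c, r⟩ he
    rw [mem_ringV] at he
    unfold RingEdge at he
    dsimp only at he
    have h1 : (c, r) ∈ gridBox q p := by rw [mem_gridBox]; dsimp only; omega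
    have h2 : (c, r) + (0, 1) ∈ gridBox q p := by
      rw [mem_gridBox]; simp only [Prod.mk_add_mk, add_zero]; omega
    rw [multV, ind_of_mem h1, ind_of_mem h2]
    simp [ind]
  · rintro ⟨c, r⟩ he
    rw [mem_ringH] at he
    unfold RingEdge at he
    dsimp only at he
    have h1 : (c, r) ∈ gridBox q p := by rw [mem_gridBox]; dsimp only; omega
    have h2 : (c, r) + (1, 0) ∈ gridBox q p := by
      rw [mem_gridBox]; simp only [Prod.mk_add_mk, add_zero]; omega
    rw [multH, ind_of_mem h1, ind_of_mem h2]
    simp [ind]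

namespace GridCover

variable {q p m : ℤ} {X S : Finset (ℤ × ℤ)}

theorem one_le_multH (h : GridCover q p X S) {e : ℤ × ℤ} (he : e ∈ ringH q p) :
    1 ≤ multH X S e := by
  obtain ⟨c, r⟩ := e
  rw [mem_ringH] at he
  obtain ⟨h1, h2, h3, h4, -⟩ := he
  have a1 := ind_nonneg X (c, r)
  have a2 := ind_nonneg X ((c, r) + (1, 0))
  have a3 := ind_nonneg S (c, r)
  have a4 := ind_nonneg S ((c, r) + (0, -1))
  unfold multH
  rcases h.covH c r h1 h2 h3 h4 with h5 | h5 | h5 | h5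
  · have := ind_of_mem h5
    omega
  · have : ind X ((c, r) + (1, 0)) = 1 := ind_of_mem (by simpa using h5)
    omega
  · have := ind_of_mem h5
    omega
  · have : ind S ((c, r) + (0, -1)) = 1 := ind_of_mem (by simpa [sub_eq_add_neg] using h5)
    omega

theorem one_le_multV (h : GridCover q p X S) {e : ℤ × ℤ} (he : e ∈ ringV q p) :
    1 ≤ multV X S e := by
  obtain ⟨c, r⟩ := e
  rw [mem_ringV] at he
  obtain ⟨h1, h2, h3, h4, -⟩ := he
  have a1 := ind_nonneg X (c, r)
  have a2 := ind_nonneg X ((c, r) + (0, 1))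
  have a3 := ind_nonneg S (c, r)
  have a4 := ind_nonneg S ((c, r) + (-1, 0))
  unfold multV
  rcases h.covV c r h3 h4 h1 h2 with h5 | h5 | h5 | h5
  · have := ind_of_mem h5
    omega
  · have : ind X ((c, r) + (0, 1)) = 1 := ind_of_mem (by simpa using h5)
    omega
  · have := ind_of_mem h5
    omega
  · have : ind S ((c, r) + (-1, 0)) = 1 := ind_of_mem (by simpa [sub_eq_add_neg] using h5)
    omega

theorem card_ring_le (h : GridCover q p X S) : ((ringH q p).card : ℤ) + (ringV q p).card ≤
    ∑ e ∈ ringH q p, multH X S e + ∑ e ∈ ringV q p, multV X S e := by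
  refine add_le_add ?_ ?_
  · simpa using Finset.sum_le_sum fun e he => h.one_le_multH he
  · simpa using Finset.sum_le_sum fun e he => h.one_le_multV he

/-- The ring bound for an odd number of rows. -/
theorem le_card_of_odd (h : GridCover q (2 * m + 1) X S) (hm : 0 ≤ m) (hq : 2 * m + 1 ≤ q) :
    q * (2 * m + 1) - 1 ≤ 2 * ((X.card : ℤ) + S.card) := by
  have hdeg : ∀ v ∈ gridBox q (2 * m + 1), ringDegree q (2 * m + 1) v =
      2 - (if v.1 = m ∧ v.2 = m then 1 else 0) - (if v.1 = q - 1 - m ∧ v.2 = m then 1 else 0) := by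
    rintro ⟨c, r⟩ hv
    rw [mem_gridBox] at hv
    rw [ringDegree_eq, ringDegree_odd hq hv.1 hv.2.1 hv.2.2.1 hv.2.2.2]
  have h1 := two_mul_card_ring q (2 * m + 1)
  rw [Finset.sum_congr rfl hdeg, Finset.sum_sub_distrib, Finset.sum_sub_distrib, sum_ite_eq_ind,
    sum_ite_eq_ind, Finset.sum_const, nsmul_eq_mul, card_gridBox (by omega) (by omega)] at h1
  have h2 := h.card_ring_le
  rw [double_count] at h2
  have h3 : ∑ v ∈ X, ringDegree q (2 * m + 1) v ≤ ∑ v ∈ X, 2 := by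
    refine Finset.sum_le_sum fun v hv => ?_
    rw [hdeg v (mem_gridBox.2 (h.vertex v hv))]
    split_ifs <;> norm_num
  have h4 : ∑ s ∈ S, ringCount q (2 * m + 1) s ≤ ∑ s ∈ S, 2 := by
    refine Finset.sum_le_sum fun s hs => ?_
    obtain ⟨c, r⟩ := s
    obtain ⟨a1, a2, a3, a4⟩ := h.square _ hs
    rw [ringCount_eq]
    exact ringCount_odd hq a1 a2 a3 a4
  rw [Finset.sum_const, nsmul_eq_mul] at h3 h4
  have h5 := ind_le_one (gridBox q (2 * m + 1)) (m, m)
  have h6 := ind_le_one (gridBox q (2 * m + 1)) (q - 1 - m, m)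
  linarith

theorem card_ring_even (hm : 0 ≤ m) (hq : 2 * m + 2 ≤ q) :
    ((ringH q (2 * m + 2)).card : ℤ) + (ringV q (2 * m + 2)).card = q * (2 * m + 2) := by
  have h1 := two_mul_card_ring q (2 * m + 2)
  rw [Finset.sum_congr rfl (g := fun _ => (2 : ℤ)), Finset.sum_const, nsmul_eq_mul,
    card_gridBox (by omega) (by omega)] at h1
  · linarith
  · rintro ⟨c, r⟩ hv
    rw [mem_gridBox] at hv
    rw [ringDegree_eq, ringDegree_even hq hv.1 hv.2.1 hv.2.2.1 hv.2.2.2]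

/-- Stars and squares cover two ring edges each, apart from one more for each end of the innermost
ring. -/
theorem sum_mult_le_of_even (h : GridCover q (2 * m + 2) X S) (hq : 2 * m + 2 ≤ q) :
    ∑ e ∈ ringH q (2 * m + 2), multH X S e + ∑ e ∈ ringV q (2 * m + 2), multV X S e ≤
      2 * ((X.card : ℤ) + S.card) + ind S (m, m) + ind S (q - 2 - m, m) := by
  rw [double_count]
  have h3 : ∑ v ∈ X, ringDegree q (2 * m + 2) v ≤ ∑ v ∈ X, 2 := by
    refine Finset.sum_le_sum fun v hv => ?_
    obtain ⟨c, r⟩ := v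
    obtain ⟨a1, a2, a3, a4⟩ := h.vertex _ hv
    rw [ringDegree_eq, ringDegree_even hq a1 a2 a3 a4]
  have h4 : ∑ s ∈ S, ringCount q (2 * m + 2) s ≤ ∑ s ∈ S, (2 + (if s.1 = m ∧ s.2 = m then 1 else 0)
        + (if s.1 = q - 2 - m ∧ s.2 = m then 1 else 0)) := by
    refine Finset.sum_le_sum fun s hs => ?_
    obtain ⟨c, r⟩ := s
    obtain ⟨a1, a2, a3, a4⟩ := h.square _ hs
    rw [ringCount_eq]
    exact ringCount_even hq a1 a2 a3 a4
  rw [Finset.sum_add_distrib, Finset.sum_add_distrib, sum_ite_eq_ind, sum_ite_eq_ind] at h4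
  rw [Finset.sum_const, nsmul_eq_mul] at h3 h4
  linarith

/-- The ring bound for an even number of rows. -/
theorem le_card_of_even (h : GridCover q (2 * m + 2) X S) (hm : 0 ≤ m) (hq : 2 * m + 2 ≤ q) :
    q * (m + 1) - 1 ≤ (X.card : ℤ) + S.card := by
  have h1 := h.card_ring_le
  rw [card_ring_even hm hq] at h1
  have h2 := h.sum_mult_le_of_even hq
  have h5 := ind_le_one S (m, m)
  have h6 := ind_le_one S (q - 2 - m, m)
  linarith

/-- No corner of a square in `S` is a star centre. -/
def IsFull (X S : Finset (ℤ × ℤ)) : Prop :=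
  ∀ s ∈ S, ∀ a b : ℤ, (a = s.1 ∨ a = s.1 + 1) → (b = s.2 ∨ b = s.2 + 1) → (a, b) ∉ X

/-- A square one of whose corners is a star centre can be traded for a star at the opposite
corner. -/
theorem exists_isFull (n : ℕ) : ∀ {X S : Finset (ℤ × ℤ)}, GridCover q p X S → S.card = n →
    ∃ X' S', GridCover q p X' S' ∧ IsFull X' S' ∧ X'.card + S'.card ≤ X.card + S.card := by
  induction n with
  | zero =>
    intro X S h hn
    rw [Finset.card_eq_zero] at hn
    subst hn
    exact ⟨X, ∅, h, by simp [IsFull], le_rfl⟩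
  | succ n ih =>
    intro X S h hn
    by_cases hfull : IsFull X S
    · exact ⟨X, S, h, hfull, le_rfl⟩
    unfold IsFull at hfull
    push Not at hfull
    obtain ⟨⟨c, r⟩, hs, a, b, ha, hb, hv⟩ := hfull
    dsimp only at ha hb
    obtain ⟨hc0, hcq, hr0, hrp⟩ := h.square _ hs
    dsimp only at hc0 hcq hr0 hrp
    have hw : ∀ c' r', (c' = c ∨ c' = c + 1) → (r' = r ∨ r' = r + 1) → (c' = a ↔ r' = b) →
        (c', r') ∈ insert (2 * c + 1 - a, 2 * r + 1 - b) X := by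
      intro c' r' hc' hr' hab
      rw [Finset.mem_insert]
      by_cases hca : c' = a
      · rw [hca, hab.1 hca]
        exact Or.inr hv
      · left
        have : r' ≠ b := fun h' => hca (hab.2 h')
        ext <;> dsimp only <;> omega
    have hcov : GridCover q p (insert (2 * c + 1 - a, 2 * r + 1 - b) X) (S.erase (c, r)) := by
      refine ⟨fun v hv' => ?_, fun s hs' => h.square s (Finset.mem_of_mem_erase hs'),
        fun c' r' h1 h2 h3 h4 => ?_, fun c' r' h1 h2 h3 h4 => ?_⟩
      · rcases Finset.mem_insert.1 hv' with rfl | hv'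
        · dsimp only
          omega
        · exact h.vertex v hv'
      · by_cases hin : c' = c ∧ (r' = r ∨ r' = r + 1)
        · obtain ⟨rfl, hr'⟩ := hin
          by_cases hab : c' = a ↔ r' = b
          · exact Or.inl (hw c' r' (Or.inl rfl) hr' hab)
          · exact Or.inr (Or.inl (hw (c' + 1) r' (Or.inr rfl) hr' (by omega)))
        · have e1 : (c', r') ≠ (c, r) := by rw [Ne, Prod.mk.injEq]; omega
          have e2 : (c', r' - 1) ≠ (c, r) := by rw [Ne, Prod.mk.injEq]; omega
          rcases h.covH c' r' h1 h2 h3 h4 with h5 | h5 | h5 | h5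
          · exact Or.inl (Finset.mem_insert_of_mem h5)
          · exact Or.inr (Or.inl (Finset.mem_insert_of_mem h5))
          · exact Or.inr (Or.inr (Or.inl (Finset.mem_erase.2 ⟨e1, h5⟩)))
          · exact Or.inr (Or.inr (Or.inr (Finset.mem_erase.2 ⟨e2, h5⟩)))
      · by_cases hin : r' = r ∧ (c' = c ∨ c' = c + 1)
        · obtain ⟨rfl, hc'⟩ := hin
          by_cases hab : c' = a ↔ r' = b
          · exact Or.inl (hw c' r' hc' (Or.inl rfl) hab)
          · exact Or.inr (Or.inl (hw c' (r' + 1) hc' (Or.inr rfl) (by omega)))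
        · have e1 : (c', r') ≠ (c, r) := by rw [Ne, Prod.mk.injEq]; omega
          have e2 : (c' - 1, r') ≠ (c, r) := by rw [Ne, Prod.mk.injEq]; omega
          rcases h.covV c' r' h1 h2 h3 h4 with h5 | h5 | h5 | h5
          · exact Or.inl (Finset.mem_insert_of_mem h5)
          · exact Or.inr (Or.inl (Finset.mem_insert_of_mem h5))
          · exact Or.inr (Or.inr (Or.inl (Finset.mem_erase.2 ⟨e1, h5⟩)))
          · exact Or.inr (Or.inr (Or.inr (Finset.mem_erase.2 ⟨e2, h5⟩)))
    have hcard := Finset.card_erase_of_mem hs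
    obtain ⟨X', S', h1, h2, h3⟩ := ih hcov (by omega)
    have h4 := Finset.card_insert_le (2 * c + 1 - a, 2 * r + 1 - b) X
    exact ⟨X', S', h1, h2, by omega⟩

/-- A cover attaining the ring bound covers every ring edge exactly once. -/
theorem rigidCover (h : GridCover q (2 * m + 2) X S) (hfull : IsFull X S) (hm : 0 ≤ m)
    (hq : 2 * m + 2 ≤ q) (hcard : (X.card : ℤ) + S.card ≤ q * (m + 1) - 1) :
    RigidCover m q (fun c r => (0 ≤ c ∧ c < q ∧ 0 ≤ r ∧ r < 2 * m + 2) ∧ (c, r) ∉ X)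
      (fun c r => (c, r) ∈ S) := by
  have h1 := h.sum_mult_le_of_even hq
  have h2 := card_ring_even hm hq
  have h5 := ind_le_one S (m, m)
  have h6 := ind_le_one S (q - 2 - m, m)
  have hA : ∀ e ∈ ringH q (2 * m + 2), 0 ≤ multH X S e - 1 := fun e he => by
    have := h.one_le_multH he
    omega
  have hB : ∀ e ∈ ringV q (2 * m + 2), 0 ≤ multV X S e - 1 := fun e he => by
    have := h.one_le_multV he
    omega
  have hA' := Finset.sum_nonneg hA
  have hB' := Finset.sum_nonneg hB
  have hsA : ∑ e ∈ ringH q (2 * m + 2), (multH X S e - 1) =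
      ∑ e ∈ ringH q (2 * m + 2), multH X S e - (ringH q (2 * m + 2)).card := by simp
  have hsB : ∑ e ∈ ringV q (2 * m + 2), (multV X S e - 1) =
      ∑ e ∈ ringV q (2 * m + 2), multV X S e - (ringV q (2 * m + 2)).card := by simp
  have hA0 : ∑ e ∈ ringH q (2 * m + 2), (multH X S e - 1) = 0 := by linarith
  have hB0 : ∑ e ∈ ringV q (2 * m + 2), (multV X S e - 1) = 0 := by linarith
  rw [Finset.sum_eq_zero_iff_of_nonneg hA] at hA0
  rw [Finset.sum_eq_zero_iff_of_nonneg hB] at hB0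
  have hH : ∀ c r, RingEdge q (2 * m + 2) c r →
      ind X (c, r) + ind X (c + 1, r) + ind S (c, r) + ind S (c, r - 1) = 1 := fun c r he => by
    have := hA0 (c, r) (mem_ringH.2 he)
    simp only [multH, Prod.mk_add_mk, add_zero, ← sub_eq_add_neg] at this
    omega
  have hV : ∀ c r, RingEdge (2 * m + 2) q r c →
      ind X (c, r) + ind X (c, r + 1) + ind S (c, r) + ind S (c - 1, r) = 1 := fun c r he => by
    have := hB0 (c, r) (mem_ringV.2 he)
    simp only [multV, Prod.mk_add_mk, add_zero, ← sub_eq_add_neg] at this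
    omega
  have hmem : ∀ {A : Finset (ℤ × ℤ)} {v}, 1 ≤ ind A v → v ∈ A := fun {A v} hv => by
    by_contra hn
    simp [ind, hn] at hv
  have X0 := ind_nonneg X
  have S0 := ind_nonneg S
  refine ⟨fun c r hY => hY.1, fun c r hs => ?_, fun c r h7 h8 => ?_, fun c r h7 h8 => ?_,
    fun c r he h7 h8 => ?_, fun c r he => ?_, fun c r he h7 h8 => ?_, fun c r he => ?_,
    hmem (by linarith), hmem (by linarith)⟩
  · have h7 := h.square _ hs
    have h8 := hfull _ hs
    dsimp only at h7 h8
    exact ⟨⟨by omega, h8 _ _ (by simp) (by simp)⟩, ⟨by omega, h8 _ _ (by simp) (by simp)⟩,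
      ⟨by omega, h8 _ _ (by simp) (by simp)⟩, ⟨by omega, h8 _ _ (by simp) (by simp)⟩⟩
  · have := h.covH c r (by omega) (by omega) (by omega) (by omega)
    tauto
  · have := h.covV c r (by omega) (by omega) (by omega) (by omega)
    tauto
  · have := hH c r he
    rw [ind_of_mem h7, ind_of_mem h8] at this
    linarith [X0 (c, r), X0 (c + 1, r)]
  · by_contra hcon
    have := hH c r he
    unfold RingEdge at he
    rw [not_or, not_and, not_and, not_not, not_not] at hcon
    rw [ind_of_mem (hcon.1 (by omega)), ind_of_mem (hcon.2 (by omega))] at this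
    linarith [S0 (c, r), S0 (c, r - 1)]
  · have := hV c r he
    rw [ind_of_mem h7, ind_of_mem h8] at this
    linarith [X0 (c, r), X0 (c, r + 1)]
  · by_contra hcon
    have := hV c r he
    unfold RingEdge at he
    rw [not_or, not_and, not_and, not_not, not_not] at hcon
    rw [ind_of_mem (hcon.1 (by omega)), ind_of_mem (hcon.2 (by omega))] at this
    linarith [S0 (c, r), S0 (c - 1, r)]

/-- A cover attaining the ring bound exists only for the exceptional numbers of columns, among which
is the square grid (with `k = 1` and `l = 0`). -/
theorem exists_eq_of_card_le (h : GridCover q (2 * m + 2) X S) (hm : 0 ≤ m)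
    (hq : 2 * m + 2 ≤ q) (hcard : (X.card : ℤ) + S.card ≤ q * (m + 1) - 1) :
    ∃ k l : ℤ, 0 ≤ l ∧ l < k ∧ q - 1 = k * (2 * m + 1) + 2 * l := by
  rcases eq_or_lt_of_le hq with rfl | hq
  · exact ⟨1, 0, le_rfl, one_pos, by ring⟩
  · obtain ⟨X', S', h1, h2, h3⟩ := exists_isFull _ h rfl
    exact (h1.rigidCover h2 hm hq.le (by omega)).exists_eq hm hq

end GridCover

/-! ### Constructions of covers -/

namespace GridCover

variable {q p m : ℤ} {X S : Finset (ℤ × ℤ)}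

theorem of_checkerboard (q p : ℤ) (e : ℤ) (he : e = 0 ∨ e = 1) :
    GridCover q p ((gridBox q p).filter fun v => (v.1 + v.2) % 2 = e) ∅ := by
  refine ⟨fun v hv => mem_gridBox.1 (Finset.mem_filter.1 hv).1, by simp,
    fun c r h1 h2 h3 h4 => ?_, fun c r h1 h2 h3 h4 => ?_⟩ <;>
  · simp only [Finset.mem_filter, mem_gridBox, Finset.notMem_empty, or_false]
    omega

/-- The smaller colour class of the checkerboard is a cover by stars alone. -/
theorem exists_card_le (hq : 0 ≤ q) (hp : 0 ≤ p) :
    ∃ X S, GridCover q p X S ∧ 2 * ((X.card : ℤ) + S.card) ≤ q * p := by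
  have h := Finset.card_filter_add_card_filter_not (s := gridBox q p)
    (fun v : ℤ × ℤ => (v.1 + v.2) % 2 = 0)
  have h1 : ((gridBox q p).filter fun v => ¬ (v.1 + v.2) % 2 = 0) =
      (gridBox q p).filter fun v => (v.1 + v.2) % 2 = 1 :=
    Finset.filter_congr fun v _ => by omega
  rw [h1] at h
  have h2 := card_gridBox hq hp
  rcases le_total ((gridBox q p).filter fun v => (v.1 + v.2) % 2 = 0).card
    ((gridBox q p).filter fun v => (v.1 + v.2) % 2 = 1).card with h3 | h3
  · exact ⟨_, _, of_checkerboard q p 0 (Or.inl rfl), by simp only [Finset.card_empty]; omega⟩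
  · exact ⟨_, _, of_checkerboard q p 1 (Or.inr rfl), by simp only [Finset.card_empty]; omega⟩

theorem mem_image_flip {A : Finset (ℤ × ℤ)} {a c r : ℤ} :
    (c, r) ∈ A.image (fun v => (v.1, a - v.2)) ↔ (c, a - r) ∈ A := by
  simp only [Finset.mem_image, Prod.mk.injEq, Prod.exists]
  constructor
  · rintro ⟨x, y, h, rfl, rfl⟩
    simpa using h
  · exact fun h => ⟨_, _, h, rfl, by ring⟩

theorem flip (h : GridCover q p X S) :
    GridCover q p (X.image fun v => (v.1, p - 1 - v.2)) (S.image fun v => (v.1, p - 2 - v.2)) := by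
  refine ⟨?_, ?_, fun c r h1 h2 h3 h4 => ?_, fun c r h1 h2 h3 h4 => ?_⟩
  · rintro ⟨c, r⟩ hv
    have := h.vertex _ (mem_image_flip.1 hv)
    dsimp only at this ⊢
    omega
  · rintro ⟨c, r⟩ hv
    have := h.square _ (mem_image_flip.1 hv)
    dsimp only at this ⊢
    omega
  · simp only [mem_image_flip]
    have := h.covH c (p - 1 - r) h1 h2 (by omega) (by omega)
    rw [show p - 2 - (r - 1) = p - 1 - r by ring, show p - 2 - r = p - 1 - r - 1 by ring]
    tauto
  · simp only [mem_image_flip]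
    have := h.covV c (p - 2 - r) h1 h2 (by omega) (by omega)
    rw [show p - 2 - r + 1 = p - 1 - r by ring] at this
    rw [show p - 1 - (r + 1) = p - 2 - r by ring]
    tauto

end GridCover

/-- The vertices of column `c` in the rows of parity `e`, for `2 * m + 2` rows. -/
noncomputable def halfColumn (m c e : ℤ) : Finset (ℤ × ℤ) :=
  (Finset.Ico 0 (m + 1)).image fun j => (c, 2 * j + e)

theorem mem_halfColumn {m c e a b : ℤ} (he : e = 0 ∨ e = 1) :
    (a, b) ∈ halfColumn m c e ↔ a = c ∧ 0 ≤ b ∧ b < 2 * m + 2 ∧ b % 2 = e := by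
  simp only [halfColumn, Finset.mem_image, Finset.mem_Ico, Prod.mk.injEq]
  constructor
  · rintro ⟨j, hj, rfl, rfl⟩
    omega
  · rintro ⟨rfl, h1, h2, h3⟩
    exact ⟨b / 2, by omega, rfl, by omega⟩

theorem card_halfColumn_le {m c e : ℤ} (hm : 0 ≤ m) : ((halfColumn m c e).card : ℤ) ≤ m + 1 := by
  have h : (halfColumn m c e).card ≤ (Finset.Ico 0 (m + 1)).card := Finset.card_image_le
  rw [Int.card_Ico] at h
  omega

theorem card_halfColumn_erase_le {m c e r : ℤ} (hm : 0 ≤ m) (he : e = 0 ∨ e = 1) (h0 : 0 ≤ r)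
    (hr : r < 2 * m + 2) (hre : r % 2 = e) :
    (((halfColumn m c e).erase (c, r)).card : ℤ) ≤ m := by
  have h1 := card_halfColumn_le (c := c) (e := e) hm
  have h2 := Finset.card_erase_add_one ((mem_halfColumn (m := m) (c := c) he).2 ⟨rfl, h0, hr, hre⟩)
  omega

/-- A cover of the first `q` columns of a grid with `2 * m + 2` rows in which one edge, from
`(q - 1, r)` down to `(q - 1, r + 1)`, is left to a square of the next column, and in which the rows
of the parity of `r`, apart from `r`, are star centres in the last column. -/
structure PartialCover (m q r : ℤ) (X S : Finset (ℤ × ℤ)) : Prop where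
  vertex : ∀ v ∈ X, 0 ≤ v.1 ∧ v.1 < q ∧ 0 ≤ v.2 ∧ v.2 < 2 * m + 2
  square : ∀ s ∈ S, 0 ≤ s.1 ∧ s.1 + 1 < q ∧ 0 ≤ s.2 ∧ s.2 + 1 < 2 * m + 2
  covH : ∀ c r, 0 ≤ c → c + 1 < q → 0 ≤ r → r < 2 * m + 2 →
    (c, r) ∈ X ∨ (c + 1, r) ∈ X ∨ (c, r) ∈ S ∨ (c, r - 1) ∈ S
  covV : ∀ c r', 0 ≤ c → c < q → 0 ≤ r' → r' + 1 < 2 * m + 2 → ¬ (c = q - 1 ∧ r' = r) →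
    (c, r') ∈ X ∨ (c, r' + 1) ∈ X ∨ (c, r') ∈ S ∨ (c - 1, r') ∈ S
  last : ∀ r', 0 ≤ r' → r' < 2 * m + 2 → r' % 2 = r % 2 → r' ≠ r → (q - 1, r') ∈ X
  card : (X.card : ℤ) + S.card ≤ q * (m + 1) - 1

namespace PartialCover

variable {m q r : ℤ} {X S : Finset (ℤ × ℤ)}

/-- The first column. -/
theorem one (hm : 0 ≤ m) : PartialCover m 1 0 ((halfColumn m 0 0).erase (0, 0)) ∅ := by
  refine ⟨?_, by simp, fun c r h1 h2 => by omega, fun c r' h1 h2 h3 h4 h5 => ?_,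
    fun r' h1 h2 h3 h4 => ?_, ?_⟩
  · rintro ⟨a, b⟩ hv
    rw [Finset.mem_erase, mem_halfColumn (Or.inl rfl)] at hv
    dsimp only
    omega
  · simp only [Finset.mem_erase, mem_halfColumn (Or.inl rfl), Ne, Prod.mk.injEq]
    omega
  · simp only [Finset.mem_erase, mem_halfColumn (Or.inl rfl), Ne, Prod.mk.injEq]
    omega
  · have := card_halfColumn_erase_le (c := 0) hm (Or.inl rfl) le_rfl
      (by omega : (0 : ℤ) < 2 * m + 2) (by simp)
    simp only [Finset.card_empty]
    push_cast
    linarith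

/-- Adding a column: the new square covers the open edge of the old column, and the open edge moves
one row down. -/
theorem step (h : PartialCover m q r X S) (hm : 0 ≤ m) (hq : 1 ≤ q) (hr : 0 ≤ r)
    (hrm : r + 1 < 2 * m + 2) :
    PartialCover m (q + 1) (r + 1) (X ∪ (halfColumn m q ((r + 1) % 2)).erase (q, r + 1))
      (insert (q - 1, r) S) := by
  have he : (r + 1) % 2 = 0 ∨ (r + 1) % 2 = 1 := by omega
  have hmem : ∀ {a b : ℤ}, (a, b) ∈ (halfColumn m q ((r + 1) % 2)).erase (q, r + 1) ↔
      a = q ∧ 0 ≤ b ∧ b < 2 * m + 2 ∧ b % 2 = (r + 1) % 2 ∧ b ≠ r + 1 := by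
    intro a b
    rw [Finset.mem_erase, mem_halfColumn he, Ne, Prod.mk.injEq]
    omega
  refine ⟨?_, ?_, fun c r' h1 h2 h3 h4 => ?_, fun c r' h1 h2 h3 h4 h5 => ?_,
    fun r' h1 h2 h3 h4 => ?_, ?_⟩
  · rintro ⟨a, b⟩ hv
    rcases Finset.mem_union.1 hv with hv | hv
    · have := h.vertex _ hv
      omega
    · rw [hmem] at hv
      dsimp only
      omega
  · rintro ⟨a, b⟩ hv
    rcases Finset.mem_insert.1 hv with hv | hv
    · rw [Prod.mk.injEq] at hv
      dsimp only
      omega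
    · have := h.square _ hv
      omega
  · simp only [Finset.mem_union, hmem, Finset.mem_insert, Prod.mk.injEq]
    by_cases hc : c + 1 < q
    · have := h.covH c r' h1 hc h3 h4
      rcases this with h5 | h5 | h5 | h5
      exacts [Or.inl (Or.inl h5), Or.inr (Or.inl (Or.inl h5)), Or.inr (Or.inr (Or.inl (Or.inr h5))),
        Or.inr (Or.inr (Or.inr (Or.inr h5)))]
    · obtain rfl : c = q - 1 := by omega
      by_cases hl : r' % 2 = r % 2 ∧ r' ≠ r
      · exact Or.inl (Or.inl (h.last r' h3 h4 hl.1 hl.2))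
      · have : (r' % 2 = (r + 1) % 2 ∧ r' ≠ r + 1) ∨ r' = r ∨ r' - 1 = r := by omega
        rcases this with h5 | h5 | h5
        exacts [Or.inr (Or.inl (Or.inr ⟨by omega, h3, h4, h5.1, h5.2⟩)),
          Or.inr (Or.inr (Or.inl (Or.inl ⟨rfl, h5⟩))), Or.inr (Or.inr (Or.inr (Or.inl ⟨rfl, h5⟩)))]
  · simp only [Finset.mem_union, hmem, Finset.mem_insert, Prod.mk.injEq]
    by_cases hc : c < q
    · by_cases hex : c = q - 1 ∧ r' = r
      · exact Or.inr (Or.inr (Or.inl (Or.inl hex)))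
      · have := h.covV c r' h1 hc h3 h4 hex
        rcases this with h6 | h6 | h6 | h6
        exacts [Or.inl (Or.inl h6), Or.inr (Or.inl (Or.inl h6)),
          Or.inr (Or.inr (Or.inl (Or.inr h6))),
          Or.inr (Or.inr (Or.inr (Or.inr h6)))]
    · obtain rfl : c = q := by omega
      simp only [add_sub_cancel_right, true_and] at h5
      have : (r' % 2 = (r + 1) % 2 ∧ r' ≠ r + 1) ∨ ((r' + 1) % 2 = (r + 1) % 2 ∧ r' + 1 ≠ r + 1) ∨
        r' = r := by omega
      have h6 : 0 ≤ r' + 1 := by omega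
      have h7 : r' < 2 * m + 2 := by omega
      rcases this with h8 | h8 | h8
      exacts [Or.inl (Or.inr ⟨rfl, h3, h7, h8.1, h8.2⟩),
        Or.inr (Or.inl (Or.inr ⟨rfl, h6, h4, h8.1, h8.2⟩)),
        Or.inr (Or.inr (Or.inr (Or.inl ⟨rfl, h8⟩)))]
  · rw [Finset.mem_union, hmem]
    right
    omega
  · have h1 := card_halfColumn_erase_le (c := q) hm he (by omega) hrm rfl
    have h2 := Finset.card_union_le X ((halfColumn m q ((r + 1) % 2)).erase (q, r + 1))
    have h3 := Finset.card_insert_le (q - 1, r) S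
    have h4 := h.card
    have h5 : (q + 1) * (m + 1) - 1 = q * (m + 1) - 1 + m + 1 := by ring
    omega

theorem steps (h : PartialCover m q 0 X S) (hm : 0 ≤ m) (hq : 1 ≤ q) (n : ℕ)
    (hn : (n : ℤ) ≤ 2 * m + 1) : ∃ X' S', PartialCover m (q + n) n X' S' := by
  induction n with
  | zero => exact ⟨X, S, by simpa using h⟩
  | succ n ih =>
    push_cast at hn ⊢
    obtain ⟨X', S', h'⟩ := ih (by omega)
    exact ⟨_, _, by simpa [add_assoc] using h'.step hm (by omega) (by omega) (by omega)⟩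

/-- There is a cover of `q` columns that attains the ring bound and whose last column has a star in
every row of positive even index. It can be continued by a further diagonal of squares. -/
def Extendable (m q : ℤ) : Prop :=
  ∃ X S, GridCover q (2 * m + 2) X S ∧
    (∀ r, 0 < r → r < 2 * m + 2 → r % 2 = 0 → (q - 1, r) ∈ X) ∧
    (X.card : ℤ) + S.card ≤ q * (m + 1) - 1

/-- After `2 * m + 1` steps the open edge has left the grid; reversing the rows restores the parity
of the last column. -/
theorem extendable_of_zero (h : PartialCover m q 0 X S) (hm : 0 ≤ m) (hq : 1 ≤ q) :
    Extendable m (q + (2 * m + 1)) := by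
  obtain ⟨X', S', h'⟩ := h.steps hm hq (2 * m + 1).toNat (by omega)
  rw [show ((2 * m + 1).toNat : ℤ) = 2 * m + 1 by omega] at h'
  have hg : GridCover (q + (2 * m + 1)) (2 * m + 2) X' S' :=
    ⟨h'.vertex, h'.square, h'.covH, fun c r h1 h2 h3 h4 => h'.covV c r h1 h2 h3 h4 (by omega)⟩
  refine ⟨_, _, hg.flip, fun r h1 h2 h3 => ?_, ?_⟩
  · rw [GridCover.mem_image_flip]
    exact h'.last _ (by omega) (by omega) (by omega) (by omega)
  · have h1 := h'.card
    have h2 : (X'.image fun v => (v.1, 2 * m + 2 - 1 - v.2)).card ≤ X'.card :=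
      Finset.card_image_le
    have h3 : (S'.image fun v => (v.1, 2 * m + 2 - 2 - v.2)).card ≤ S'.card :=
      Finset.card_image_le
    omega

theorem Extendable.add (h : Extendable m q) (hm : 0 ≤ m) (hq : 1 ≤ q) :
    Extendable m (q + (2 * m + 1)) := by
  obtain ⟨X, S, hg, hl, hcard⟩ := h
  exact extendable_of_zero (X := X) (S := S) ⟨hg.vertex, hg.square, hg.covH,
    fun c r' h1 h2 h3 h4 _ => hg.covV c r' h1 h2 h3 h4,
    fun r' h1 h2 h3 h4 => hl r' (by omega) h2 (by omega), hcard⟩ hm hq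

/-- Two columns without squares can be inserted before the next diagonal: the first has stars in row
`0` and in the odd rows, the second in the positive even rows. -/
theorem Extendable.add_two (h : Extendable m q) (hm : 0 ≤ m) (hq : 1 ≤ q) :
    Extendable m (q + 2 + (2 * m + 1)) := by
  obtain ⟨X, S, hg, hl, hcard⟩ := h
  have hmem : ∀ {a b : ℤ}, (a, b) ∈ insert (q, 0) (halfColumn m q 1) ∪
      (halfColumn m (q + 1) 0).erase (q + 1, 0) ↔
      (a = q ∧ 0 ≤ b ∧ b < 2 * m + 2 ∧ (b = 0 ∨ b % 2 = 1)) ∨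
      (a = q + 1 ∧ 0 < b ∧ b < 2 * m + 2 ∧ b % 2 = 0) := by
    intro a b
    rw [Finset.mem_union, Finset.mem_insert, Finset.mem_erase, mem_halfColumn (Or.inr rfl),
      mem_halfColumn (Or.inl rfl), Ne, Prod.mk.injEq, Prod.mk.injEq]
    omega
  refine extendable_of_zero (X := X ∪ (insert (q, 0) (halfColumn m q 1) ∪
    (halfColumn m (q + 1) 0).erase (q + 1, 0))) (S := S)
    ⟨?_, fun s hs => ?_, fun c r' h1 h2 h3 h4 => ?_, fun c r' h1 h2 h3 h4 h5 => ?_,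
      fun r' h1 h2 h3 h4 => ?_, ?_⟩ hm (by omega)
  · rintro ⟨a, b⟩ hv
    rcases Finset.mem_union.1 hv with hv | hv
    · have := hg.vertex _ hv
      omega
    · rw [hmem] at hv
      dsimp only
      omega
  · have := hg.square s hs
    omega
  · rw [Finset.mem_union (s := X), Finset.mem_union (s := X), hmem, hmem]
    by_cases hc : c + 1 < q
    · have := hg.covH c r' h1 hc h3 h4
      rcases this with h6 | h6 | h6 | h6
      exacts [Or.inl (Or.inl h6), Or.inr (Or.inl (Or.inl h6)), Or.inr (Or.inr (Or.inl h6)),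
        Or.inr (Or.inr (Or.inr h6))]
    · by_cases hc' : c = q - 1 ∧ 0 < r' ∧ r' % 2 = 0
      · obtain ⟨rfl, h5, h6⟩ := hc'
        exact Or.inl (Or.inl (hl r' h5 h4 h6))
      · have : ((c = q ∧ 0 ≤ r' ∧ r' < 2 * m + 2 ∧ (r' = 0 ∨ r' % 2 = 1)) ∨
            (c = q + 1 ∧ 0 < r' ∧ r' < 2 * m + 2 ∧ r' % 2 = 0)) ∨
          ((c + 1 = q ∧ 0 ≤ r' ∧ r' < 2 * m + 2 ∧ (r' = 0 ∨ r' % 2 = 1)) ∨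
            (c + 1 = q + 1 ∧ 0 < r' ∧ r' < 2 * m + 2 ∧ r' % 2 = 0)) := by omega
        exact this.imp Or.inr fun h6 => Or.inl (Or.inr h6)
  · rw [Finset.mem_union (s := X), Finset.mem_union (s := X), hmem, hmem]
    by_cases hc : c < q
    · have := hg.covV c r' h1 hc h3 h4
      rcases this with h6 | h6 | h6 | h6
      exacts [Or.inl (Or.inl h6), Or.inr (Or.inl (Or.inl h6)), Or.inr (Or.inr (Or.inl h6)),
        Or.inr (Or.inr (Or.inr h6))]
    · have : ((c = q ∧ 0 ≤ r' ∧ r' < 2 * m + 2 ∧ (r' = 0 ∨ r' % 2 = 1)) ∨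
            (c = q + 1 ∧ 0 < r' ∧ r' < 2 * m + 2 ∧ r' % 2 = 0)) ∨
          ((c = q ∧ 0 ≤ r' + 1 ∧ r' + 1 < 2 * m + 2 ∧ (r' + 1 = 0 ∨ (r' + 1) % 2 = 1)) ∨
            (c = q + 1 ∧ 0 < r' + 1 ∧ r' + 1 < 2 * m + 2 ∧ (r' + 1) % 2 = 0)) := by omega
      exact this.imp Or.inr fun h6 => Or.inl (Or.inr h6)
  · rw [Finset.mem_union, hmem]
    right
    omega
  · have h1 := card_halfColumn_erase_le (c := q + 1) hm (Or.inl rfl) le_rfl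
      (by omega : (0 : ℤ) < 2 * m + 2) (by simp)
    have h2 := card_halfColumn_le (c := q) (e := 1) hm
    have h3 := Finset.card_insert_le (q, 0) (halfColumn m q 1)
    have h4 := Finset.card_union_le (insert (q, 0) (halfColumn m q 1))
      ((halfColumn m (q + 1) 0).erase (q + 1, 0))
    have h5 := Finset.card_union_le X (insert (q, 0) (halfColumn m q 1) ∪
      (halfColumn m (q + 1) 0).erase (q + 1, 0))
    have h6 : (q + 2) * (m + 1) - 1 = q * (m + 1) - 1 + (2 * m + 2) := by ring
    omega

/-- Every diagonal after the first may be preceded by two columns without squares. -/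
theorem extendable (hm : 0 ≤ m) (k : ℕ) : ∀ l : ℕ, l ≤ k →
    Extendable m (1 + (k + 1) * (2 * m + 1) + 2 * l) := by
  induction k with
  | zero =>
    intro l hl
    obtain rfl : l = 0 := by omega
    simpa using extendable_of_zero (one hm) hm le_rfl
  | succ k ih =>
    intro l hl
    rcases Nat.lt_or_ge k l with h1 | h1
    · obtain rfl : l = k + 1 := by omega
      have h2 := (ih k le_rfl).add_two hm (by
        have : 0 ≤ ((k : ℤ) + 1) * (2 * m + 1) := by positivity
        omega)
      convert h2 using 1
      push_cast
      ring
    · have h2 := (ih l h1).add hm (by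
        have : 0 ≤ ((k : ℤ) + 1) * (2 * m + 1) := by positivity
        omega)
      convert h2 using 1
      push_cast
      ring

end PartialCover

theorem GridCover.exists_card_le_of_eq {m q k l : ℤ} (hm : 0 ≤ m) (hl : 0 ≤ l) (hlk : l < k)
    (hq : q - 1 = k * (2 * m + 1) + 2 * l) :
    ∃ X S, GridCover q (2 * m + 2) X S ∧ (X.card : ℤ) + S.card ≤ q * (m + 1) - 1 := by
  obtain ⟨X, S, h1, -, h2⟩ := PartialCover.extendable hm (k - 1).toNat l.toNat (by omega)
  rw [show 1 + (((k - 1).toNat : ℤ) + 1) * (2 * m + 1) + 2 * (l.toNat : ℤ) = q by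
    rw [show ((k - 1).toNat : ℤ) = k - 1 by omega, show (l.toNat : ℤ) = l by omega]
    linear_combination -hq] at h1 h2
  exact ⟨X, S, h1, h2⟩

/-! ### Bicliques of the grid -/

section Bicliques

variable {p q : ℕ}

/-- The position of a vertex of the grid graph in integer coordinates, column first. -/
def gridPos (u : Fin q × Fin p) : ℤ × ℤ := (((u.1 : ℕ) : ℤ), ((u.2 : ℕ) : ℤ))

theorem gridPos_bounds (u : Fin q × Fin p) :
    0 ≤ (gridPos u).1 ∧ (gridPos u).1 < q ∧ 0 ≤ (gridPos u).2 ∧ (gridPos u).2 < p := by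
  have h1 := u.1.2
  have h2 := u.2.2
  simp only [gridPos]
  omega

theorem gridPos_injective : Function.Injective (gridPos : Fin q × Fin p → ℤ × ℤ) := by
  intro u v h
  simp only [gridPos, Prod.mk.injEq, Nat.cast_inj, Fin.val_inj] at h
  exact Prod.ext h.1 h.2

theorem exists_gridPos_eq {c r : ℤ} (hc : 0 ≤ c) (hcq : c < q) (hr : 0 ≤ r) (hrp : r < p) :
    ∃ u : Fin q × Fin p, gridPos u = (c, r) :=
  ⟨(⟨c.toNat, by omega⟩, ⟨r.toNat, by omega⟩), by simp [gridPos, hc, hr]⟩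

/-- Two points at distance one on the integer grid. -/
def UnitApart (x y : ℤ × ℤ) : Prop :=
  (x.2 = y.2 ∧ (x.1 + 1 = y.1 ∨ y.1 + 1 = x.1)) ∨ (x.1 = y.1 ∧ (x.2 + 1 = y.2 ∨ y.2 + 1 = x.2))

theorem gridGraph_adj {u v : Fin q × Fin p} :
    (gridGraph p q).Adj u v ↔ UnitApart (gridPos u) (gridPos v) := by
  simp only [gridGraph, UnitApart, gridPos]
  generalize ((u.1 : ℕ) : ℤ) = a
  generalize ((u.2 : ℕ) : ℤ) = b
  generalize ((v.1 : ℕ) : ℤ) = c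
  generalize ((v.2 : ℕ) : ℤ) = d
  rcases abs_cases (a - c) with h1 | h1 <;> rcases abs_cases (b - d) with h2 | h2 <;> omega

/-- The numbers `x` and `y` are `c` and `c + 1`, in some order. -/
def Consecutive (c x y : ℤ) : Prop := (x = c ∧ y = c + 1) ∨ (x = c + 1 ∧ y = c)

/-- A `4`-cycle of the grid is a unit square. -/
theorem exists_square {a a' b b' : ℤ × ℤ} (h1 : UnitApart a b) (h2 : UnitApart a b')
    (h3 : UnitApart a' b) (h4 : UnitApart a' b') (ha : a ≠ a') (hb : b ≠ b') :
    ∃ c r, Consecutive c a.1 a'.1 ∧ Consecutive r a.2 a'.2 ∧ Consecutive c b.1 b'.1 ∧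
      Consecutive r b.2 b'.2 := by
  obtain ⟨a1, a2⟩ := a
  obtain ⟨a1', a2'⟩ := a'
  obtain ⟨b1, b2⟩ := b
  obtain ⟨b1', b2'⟩ := b'
  simp only [UnitApart, Ne, Prod.mk.injEq, Consecutive] at *
  refine ⟨min a1 a1', min a2 a2', ?_⟩
  rcases h1 with ⟨h1, h5 | h5⟩ | ⟨h1, h5 | h5⟩ <;> rcases h2 with ⟨h2, h6 | h6⟩ | ⟨h2, h6 | h6⟩ <;>
    first
    | (exfalso; omega)
    | (rcases h3 with ⟨h3, h7 | h7⟩ | ⟨h3, h7 | h7⟩ <;>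
        first
        | (exfalso; omega)
        | omega)

theorem mem_square {b b' u : ℤ × ℤ} {c r : ℤ} (hb1 : Consecutive c b.1 b'.1)
    (hb2 : Consecutive r b.2 b'.2) (h1 : UnitApart u b) (h2 : UnitApart u b') :
    c ≤ u.1 ∧ u.1 ≤ c + 1 ∧ r ≤ u.2 ∧ u.2 ≤ r + 1 := by
  unfold UnitApart Consecutive at *
  omega

theorem UnitApart.symm {x y : ℤ × ℤ} (h : UnitApart x y) : UnitApart y x := by
  unfold UnitApart at *
  omega

/-- The edges of `H` are covered by the star centred at `v` (for `Sum.inl v`), or all ends of edges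
of `H` are corners of the unit square `s` (for `Sum.inr s`). -/
def IsCode (H : (gridGraph p q).Subgraph) : (ℤ × ℤ) ⊕ (ℤ × ℤ) → Prop :=
  Sum.elim
    (fun v => (0 ≤ v.1 ∧ v.1 < q ∧ 0 ≤ v.2 ∧ v.2 < p) ∧
      ∀ u w, H.Adj u w → gridPos u = v ∨ gridPos w = v)
    (fun s => (0 ≤ s.1 ∧ s.1 + 1 < q ∧ 0 ≤ s.2 ∧ s.2 + 1 < p) ∧
      ∀ u w, H.Adj u w → s.1 ≤ (gridPos u).1 ∧ (gridPos u).1 ≤ s.1 + 1 ∧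
        s.2 ≤ (gridPos u).2 ∧ (gridPos u).2 ≤ s.2 + 1)

/-- A biclique of the grid is part of a star or of a unit square. -/
theorem IsBiclique.exists_isCode {H : (gridGraph p q).Subgraph} (h : IsBiclique H) :
    ∃ x, IsCode H x := by
  obtain ⟨A, B, ⟨a, ha⟩, ⟨b, hb⟩, -, -, hadj⟩ := h
  have hAB : ∀ x ∈ A, ∀ y ∈ B, UnitApart (gridPos x) (gridPos y) := fun x hx y hy =>
    gridGraph_adj.1 (H.adj_sub ((hadj x y).2 (Or.inl ⟨hx, hy⟩)))
  by_cases hA : ∀ x ∈ A, x = a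
  · refine ⟨Sum.inl (gridPos a), gridPos_bounds a, fun u w huw => ?_⟩
    rcases (hadj u w).1 huw with h1 | h1
    · exact Or.inl (by rw [hA u h1.1])
    · exact Or.inr (by rw [hA w h1.2])
  by_cases hB : ∀ x ∈ B, x = b
  · refine ⟨Sum.inl (gridPos b), gridPos_bounds b, fun u w huw => ?_⟩
    rcases (hadj u w).1 huw with h1 | h1
    · exact Or.inr (by rw [hB w h1.2])
    · exact Or.inl (by rw [hB u h1.1])
  push Not at hA hB
  obtain ⟨a', ha', haa⟩ := hA
  obtain ⟨b', hb', hbb⟩ := hB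
  obtain ⟨c, r, h1, h2, h3, h4⟩ := exists_square (hAB a ha b hb) (hAB a ha b' hb')
    (hAB a' ha' b hb) (hAB a' ha' b' hb') (gridPos_injective.ne haa.symm)
    (gridPos_injective.ne hbb.symm)
  have ba := gridPos_bounds a
  have ba' := gridPos_bounds a'
  refine ⟨Sum.inr (c, r), ?_, fun u w huw => ?_⟩
  · unfold Consecutive at h1 h2
    dsimp only
    omega
  · rcases (hadj u w).1 huw with h5 | h5
    · exact mem_square h3 h4 (hAB u h5.1 b hb) (hAB u h5.1 b' hb')
    · exact mem_square h1 h2 (hAB a ha u h5.1).symm (hAB a' ha' u h5.1).symm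

theorem IsBicliqueCover.exists_gridCover {C : Set (gridGraph p q).Subgraph}
    (h : IsBicliqueCover (gridGraph p q) C) (hfin : C.Finite) :
    ∃ X S, GridCover q p X S ∧ X.card + S.card ≤ hfin.toFinset.card := by
  classical
  have hx : ∀ H : (gridGraph p q).Subgraph, ∃ x, H ∈ C → IsCode H x := fun H => by
    by_cases hH : H ∈ C
    · obtain ⟨x, hx⟩ := (h.1 H hH).exists_isCode
      exact ⟨x, fun _ => hx⟩
    · exact ⟨Sum.inl 0, fun h' => absurd h' hH⟩
  choose f hf using hx
  have hD : ∀ x, x ∈ hfin.toFinset.image f ↔ ∃ H ∈ C, f H = x := by simp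
  refine ⟨(hfin.toFinset.image f).toLeft, (hfin.toFinset.image f).toRight,
    ⟨fun v hv => ?_, fun s hs => ?_, fun c r h1 h2 h3 h4 => ?_, fun c r h1 h2 h3 h4 => ?_⟩, ?_⟩
  · rw [Finset.mem_toLeft, hD] at hv
    obtain ⟨H, hH, hfH⟩ := hv
    have := hf H hH
    rw [hfH] at this
    exact this.1
  · rw [Finset.mem_toRight, hD] at hs
    obtain ⟨H, hH, hfH⟩ := hs
    have := hf H hH
    rw [hfH] at this
    exact this.1
  · simp only [Finset.mem_toLeft, Finset.mem_toRight, hD]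
    obtain ⟨u, hu⟩ := exists_gridPos_eq (p := p) (q := q) h1 (by omega) h3 h4
    obtain ⟨w, hw⟩ := exists_gridPos_eq (p := p) (q := q) (by omega) h2 h3 h4
    have hadj : (gridGraph p q).Adj u w := by
      rw [gridGraph_adj, hu, hw]
      exact Or.inl ⟨rfl, Or.inl rfl⟩
    obtain ⟨H, hH, he⟩ := h.2 s(u, w) hadj
    rw [SimpleGraph.Subgraph.mem_edgeSet] at he
    have hc := hf H hH
    rcases hfH : f H with v | ⟨a, b⟩
    · rw [hfH] at hc
      rcases hc.2 u w he with rfl | rfl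
      · exact Or.inl ⟨H, hH, by rw [hfH, hu]⟩
      · exact Or.inr (Or.inl ⟨H, hH, by rw [hfH, hw]⟩)
    · rw [hfH] at hc
      have e1 := hc.2 u w he
      have e2 := hc.2 w u he.symm
      rw [hu] at e1
      rw [hw] at e2
      dsimp only at e1 e2
      obtain rfl : a = c := by omega
      obtain rfl | rfl : b = r ∨ b = r - 1 := by omega
      · exact Or.inr (Or.inr (Or.inl ⟨H, hH, hfH⟩))
      · exact Or.inr (Or.inr (Or.inr ⟨H, hH, hfH⟩))
  · simp only [Finset.mem_toLeft, Finset.mem_toRight, hD]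
    obtain ⟨u, hu⟩ := exists_gridPos_eq (p := p) (q := q) h1 h2 h3 (by omega)
    obtain ⟨w, hw⟩ := exists_gridPos_eq (p := p) (q := q) h1 h2 (by omega) h4
    have hadj : (gridGraph p q).Adj u w := by
      rw [gridGraph_adj, hu, hw]
      exact Or.inr ⟨rfl, Or.inl rfl⟩
    obtain ⟨H, hH, he⟩ := h.2 s(u, w) hadj
    rw [SimpleGraph.Subgraph.mem_edgeSet] at he
    have hc := hf H hH
    rcases hfH : f H with v | ⟨a, b⟩
    · rw [hfH] at hc
      rcases hc.2 u w he with rfl | rfl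
      · exact Or.inl ⟨H, hH, by rw [hfH, hu]⟩
      · exact Or.inr (Or.inl ⟨H, hH, by rw [hfH, hw]⟩)
    · rw [hfH] at hc
      have e1 := hc.2 u w he
      have e2 := hc.2 w u he.symm
      rw [hu] at e1
      rw [hw] at e2
      dsimp only at e1 e2
      obtain rfl : b = r := by omega
      obtain rfl | rfl : a = c ∨ a = c - 1 := by omega
      · exact Or.inr (Or.inr (Or.inl ⟨H, hH, hfH⟩))
      · exact Or.inr (Or.inr (Or.inr ⟨H, hH, hfH⟩))
  · rw [Finset.card_toLeft_add_card_toRight]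
    exact Finset.card_image_le

/-- The subgraph with vertex set `A ∪ B` and all edges of `G` between `A` and `B`. -/
def betweenSubgraph {V : Type*} (G : SimpleGraph V) (A B : Set V) : G.Subgraph where
  verts := A ∪ B
  Adj u v := G.Adj u v ∧ ((u ∈ A ∧ v ∈ B) ∨ (u ∈ B ∧ v ∈ A))
  adj_sub h := h.1
  edge_vert h := h.2.imp And.left And.left |>.elim Or.inl Or.inr
  symm := ⟨fun _ _ h => ⟨h.1.symm, h.2.symm.imp And.symm And.symm⟩⟩

theorem isBiclique_betweenSubgraph {V : Type*} {G : SimpleGraph V} {A B : Set V} (hA : A.Nonempty)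
    (hB : B.Nonempty) (h : ∀ a ∈ A, ∀ b ∈ B, G.Adj a b) : IsBiclique (betweenSubgraph G A B) := by
  refine ⟨A, B, hA, hB, Set.disjoint_left.2 fun x hx hx' => (h x hx x hx').ne rfl, rfl,
    fun u v => ⟨fun h' => h'.2, fun h' => ⟨?_, h'⟩⟩⟩
  rcases h' with h' | h'
  · exact h u h'.1 v h'.2
  · exact (h v h'.2 u h'.1).symm

/-- The star consisting of all edges at the vertex with position `v`. -/
def starSubgraph (p q : ℕ) (v : ℤ × ℤ) : (gridGraph p q).Subgraph :=
  betweenSubgraph _ {u | gridPos u = v} {w | UnitApart v (gridPos w)}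

/-- The `4`-cycle around the unit square with smallest corner `s`. -/
def squareSubgraph (p q : ℕ) (s : ℤ × ℤ) : (gridGraph p q).Subgraph :=
  betweenSubgraph _ {u | gridPos u = s ∨ gridPos u = (s.1 + 1, s.2 + 1)}
    {u | gridPos u = (s.1 + 1, s.2) ∨ gridPos u = (s.1, s.2 + 1)}

theorem isBiclique_starSubgraph {u w : Fin q × Fin p} (h : (gridGraph p q).Adj u w) :
    IsBiclique (starSubgraph p q (gridPos u)) := by
  refine isBiclique_betweenSubgraph ⟨u, rfl⟩ ⟨w, gridGraph_adj.1 h⟩ fun a ha b hb => ?_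
  rw [gridGraph_adj]
  rw [Set.mem_ofPred_eq] at ha
  rw [ha]
  exact hb

theorem isBiclique_squareSubgraph {s : ℤ × ℤ} (h : 0 ≤ s.1 ∧ s.1 + 1 < q ∧ 0 ≤ s.2 ∧ s.2 + 1 < p) :
    IsBiclique (squareSubgraph p q s) := by
  obtain ⟨u, hu⟩ := exists_gridPos_eq (p := p) (q := q) (c := s.1) (r := s.2) (by omega) (by omega)
    (by omega) (by omega)
  obtain ⟨w, hw⟩ := exists_gridPos_eq (p := p) (q := q) (c := s.1 + 1) (r := s.2) (by omega)
    (by omega) (by omega) (by omega)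
  refine isBiclique_betweenSubgraph ⟨u, Or.inl hu⟩ ⟨w, Or.inl hw⟩ fun a ha b hb => ?_
  rw [gridGraph_adj]
  rcases ha with ha | ha <;> rcases hb with hb | hb <;> rw [ha, hb] <;> unfold UnitApart <;> simp

theorem GridCover.bicliqueCoveringNumber_le {X S : Finset (ℤ × ℤ)} (h : GridCover q p X S) :
    bicliqueCoveringNumber (gridGraph p q) ≤ ((X.card + S.card : ℕ) : ℕ∞) := by
  classical
  have exists_of_covered : ∀ u w, gridPos u ∈ X ∨ gridPos w ∈ X ∨
      (∃ s ∈ S, (squareSubgraph p q s).Adj u w) → (gridGraph p q).Adj u w → ∃ H, (IsBiclique H ∧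
        H ∈ starSubgraph p q '' X ∪ squareSubgraph p q '' S) ∧ H.Adj u w := by
    rintro u w (h1 | h1 | ⟨s, hs, hadj⟩) huw
    · exact ⟨_, ⟨isBiclique_starSubgraph huw, Or.inl ⟨_, h1, rfl⟩⟩, huw,
        Or.inl ⟨rfl, gridGraph_adj.1 huw⟩⟩
    · exact ⟨_, ⟨isBiclique_starSubgraph huw.symm, Or.inl ⟨_, h1, rfl⟩⟩, huw,
        Or.inr ⟨gridGraph_adj.1 huw.symm, rfl⟩⟩
    · exact ⟨_, ⟨isBiclique_squareSubgraph (h.square s hs), Or.inr ⟨s, hs, rfl⟩⟩, hadj⟩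
  have covered_of_forward : ∀ u w : Fin q × Fin p, (gridGraph p q).Adj u w →
      ((gridPos u).2 = (gridPos w).2 ∧ (gridPos u).1 + 1 = (gridPos w).1) ∨
        ((gridPos u).1 = (gridPos w).1 ∧ (gridPos u).2 + 1 = (gridPos w).2) →
      gridPos u ∈ X ∨ gridPos w ∈ X ∨ (∃ s ∈ S, (squareSubgraph p q s).Adj u w) := by
    intro u w huw hpos
    have bu := gridPos_bounds u
    have bw := gridPos_bounds w
    rcases hpos with ⟨e1, e2⟩ | ⟨e1, e2⟩
    · have hw : gridPos w = ((gridPos u).1 + 1, (gridPos u).2) := by rw [e1, e2]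
      rcases h.covH (gridPos u).1 (gridPos u).2 bu.1 (by omega) bu.2.2.1 bu.2.2.2 with
        h1 | h1 | h1 | h1
      · exact Or.inl h1
      · exact Or.inr (Or.inl (by rwa [hw]))
      · exact Or.inr (Or.inr ⟨_, h1, huw, Or.inl ⟨Or.inl rfl, Or.inl hw⟩⟩)
      · exact Or.inr (Or.inr ⟨_, h1, huw, Or.inr ⟨Or.inr (by simp), Or.inr (by simp [hw])⟩⟩)
    · have hw : gridPos w = ((gridPos u).1, (gridPos u).2 + 1) := by rw [e1, e2]
      rcases h.covV (gridPos u).1 (gridPos u).2 bu.1 bu.2.1 bu.2.2.1 (by omega) with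
        h1 | h1 | h1 | h1
      · exact Or.inl h1
      · exact Or.inr (Or.inl (by rwa [hw]))
      · exact Or.inr (Or.inr ⟨_, h1, huw, Or.inl ⟨Or.inl rfl, Or.inr hw⟩⟩)
      · exact Or.inr (Or.inr ⟨_, h1, huw, Or.inr ⟨Or.inl (by simp), Or.inr (by simp [hw])⟩⟩)
  -- Restricting to bicliques discards the star of the only vertex of the `1 × 1` grid, which has no
  -- edges.
  refine iInf₂_le_of_le {H | IsBiclique H ∧ H ∈ starSubgraph p q '' X ∪ squareSubgraph p q '' S}
    ⟨fun H hH => hH.1, fun e => ?_⟩ ?_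
  · refine Sym2.ind (fun u w huw => ?_) e
    rw [SimpleGraph.mem_edgeSet] at huw
    simp only [SimpleGraph.Subgraph.mem_edgeSet]
    have hd := gridGraph_adj.1 huw
    by_cases hpos : ((gridPos u).2 = (gridPos w).2 ∧ (gridPos u).1 + 1 = (gridPos w).1) ∨
        ((gridPos u).1 = (gridPos w).1 ∧ (gridPos u).2 + 1 = (gridPos w).2)
    · exact exists_of_covered u w (covered_of_forward u w huw hpos) huw
    · obtain ⟨H, hH, hadj⟩ :=
        exists_of_covered w u (covered_of_forward w u huw.symm
          (by unfold UnitApart at hd; omega)) huw.symm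
      exact ⟨H, hH, hadj.symm⟩
  · calc Set.encard {H | IsBiclique H ∧ H ∈ starSubgraph p q '' X ∪ squareSubgraph p q '' S}
        ≤ (starSubgraph p q '' X ∪ squareSubgraph p q '' S).encard :=
          Set.encard_le_encard fun H hH => hH.2
      _ ≤ (starSubgraph p q '' X).encard + (squareSubgraph p q '' S).encard :=
          Set.encard_union_le _ _
      _ ≤ (X : Set (ℤ × ℤ)).encard + (S : Set (ℤ × ℤ)).encard :=
          add_le_add (Set.encard_image_le _ _) (Set.encard_image_le _ _)
      _ = ((X.card + S.card : ℕ) : ℕ∞) := by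
          rw [Set.encard_coe_eq_coe_finsetCard, Set.encard_coe_eq_coe_finsetCard, Nat.cast_add]

theorem bicliqueCoveringNumber_gridGraph_eq {n : ℕ}
    (h1 : ∃ X S, GridCover q p X S ∧ (X.card : ℤ) + S.card ≤ n)
    (h2 : ∀ X S, GridCover q p X S → (n : ℤ) ≤ X.card + S.card) :
    bicliqueCoveringNumber (gridGraph p q) = n := by
  refine le_antisymm ?_ (le_iInf₂ fun C hC => ?_)
  · obtain ⟨X, S, h, hn⟩ := h1
    refine h.bicliqueCoveringNumber_le.trans ?_
    exact_mod_cast hn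
  · by_cases hfin : C.Finite
    · obtain ⟨X, S, h, hn⟩ := hC.exists_gridCover hfin
      have := h2 X S h
      rw [hfin.encard_eq_coe_toFinset_card]
      exact_mod_cast (show n ≤ hfin.toFinset.card by omega)
    · rw [Set.Infinite.encard_eq hfin]
      exact le_top

end Bicliques

theorem theorem1 (p q : ℕ) (hp : 1 ≤ p) (hpq : p ≤ q) :
    ∃ b : ℕ, bicliqueCoveringNumber (gridGraph p q) = (b : ℕ∞) ∧
      ((Even p ∧ ∃ k l : ℤ, 0 ≤ l ∧ l < k ∧ (q : ℤ) - 1 = k * ((p : ℤ) - 1) + 2 * l) →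
        (b : ℚ) = (p : ℚ) * (q : ℚ) / 2 - 1) ∧
      (¬ (Even p ∧ ∃ k l : ℤ, 0 ≤ l ∧ l < k ∧ (q : ℤ) - 1 = k * ((p : ℤ) - 1) + 2 * l) →
        (b : ℤ) = ⌊(p : ℚ) * (q : ℚ) / 2⌋) := by
  have hfloor : ((p * q / 2 : ℕ) : ℤ) = ⌊(p : ℚ) * (q : ℚ) / 2⌋ := by
    have := Rat.floor_natCast_div_natCast (p * q) 2
    push_cast at this ⊢
    rw [this]
  by_cases hex : Even p ∧ ∃ k l : ℤ, 0 ≤ l ∧ l < k ∧ (q : ℤ) - 1 = k * ((p : ℤ) - 1) + 2 * l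
  · obtain ⟨⟨n, hn⟩, k, l, hl, hlk, hq⟩ := id hex
    obtain ⟨m, rfl⟩ : ∃ m, n = m + 1 := ⟨n - 1, by omega⟩
    have hp' : (p : ℤ) = 2 * m + 2 := by omega
    have hpos : 1 ≤ q * (m + 1) := Nat.mul_pos (by omega) (by omega)
    refine ⟨q * (m + 1) - 1, bicliqueCoveringNumber_gridGraph_eq ?_ fun X S h => ?_, fun _ => ?_,
      fun h => absurd hex h⟩
    · rw [hp'] at hq ⊢
      obtain ⟨X, S, h1, h2⟩ := GridCover.exists_card_le_of_eq (m := m) (q := q) (by omega) hl hlk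
        (by rw [hq]; ring)
      exact ⟨X, S, h1, by rw [Nat.cast_sub hpos]; push_cast; exact h2⟩
    · rw [hp'] at h
      have := h.le_card_of_even (by omega) (by omega)
      rw [Nat.cast_sub hpos]
      push_cast
      exact this
    · rw [Nat.cast_sub hpos]
      have hpQ : (p : ℚ) = 2 * m + 2 := by exact_mod_cast hp'
      rw [hpQ]
      push_cast
      ring
  · refine ⟨p * q / 2, bicliqueCoveringNumber_gridGraph_eq ?_ fun X S h => ?_,
      fun h => absurd h hex, fun _ => hfloor⟩
    · obtain ⟨X, S, h1, h2⟩ := GridCover.exists_card_le (q := (q : ℤ)) (p := p) (by omega)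
        (by omega)
      refine ⟨X, S, h1, ?_⟩
      have : (q : ℤ) * p = ((p * q : ℕ) : ℤ) := by push_cast; ring
      omega
    · have hcast : (q : ℤ) * p = ((p * q : ℕ) : ℤ) := by push_cast; ring
      rcases Nat.even_or_odd' p with ⟨n, hn | hn⟩
      · obtain ⟨m, rfl⟩ : ∃ m, n = m + 1 := ⟨n - 1, by omega⟩
        have hp' : (p : ℤ) = 2 * m + 2 := by omega
        rw [hp'] at h hcast
        by_contra hcon
        have hlt : (X.card : ℤ) + S.card ≤ q * (m + 1) - 1 := by
          have : (q : ℤ) * (2 * m + 2) = 2 * (q * (m + 1)) := by ring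
          omega
        obtain ⟨k, l, hl, hlk, hq⟩ := h.exists_eq_of_card_le (by omega) (by omega) hlt
        exact hex ⟨⟨m + 1, by omega⟩, k, l, hl, hlk, by rw [hq, hp']; ring⟩
      · have hp' : (p : ℤ) = 2 * n + 1 := by omega
        rw [hp'] at h hcast
        have := h.le_card_of_odd (by omega) (by omega)
        omega
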